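/- Let $n$ be a positive integer, let $\mathrm{Par}(n)$ be the set of partitions of $n$ with the dominance order $\trianglelefteq$, and for $\lambda\in\mathrm{Par}(n)$ let $\lambda^*$ be the transpose partition; for $\Gamma\subseteq\mathrm{Par}(n)$ put $\Gamma^*=\{\lambda^*\mid\lambda\in\Gamma\}$. For $\lambda=(\lambda_1,\dots,\lambda_m)\in\mathrm{Par}(n)$ let $\mathrm{Sym}(\lambda)=\mathrm{Sym}(X_1)\times\cdots\times\mathrm{Sym}(X_m)\le\mathrm{Sym}(n)$, where $X_1=\{1,\dots,\lambda_1\}$, $X_2=\{\lambda_1+1,\dots,\lambda_1+\lambda_2\}$, and so on. Let $R$ be a commutative ring. For $\Delta\subseteq\mathrm{Par}(n)$ let $I_R(\Delta)$ be the two-sided ideal of the group algebra $R\,\mathrm{Sym}(n)$ generated by the elements $\sum_{\sigma\in\mathrm{Sym}(\lambda)}\sigma$, $\lambda\in\Delta$, and let ${}^\dagger$ be the $R$-algebra automorphism of $R\,\mathrm{Sym}(n)$ with $\sigma^\dagger=\mathrm{sgn}(\sigma)\sigma$ for $\sigma\in\mathrm{Sym}(n)$. For $\Gamma\subseteq\mathrm{Par}(n)$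 let $G(\Gamma)$ be the set of permutations $\sigma\in\mathrm{Sym}(n)$ such that the shape of the tableaux attached to the word $\sigma(1)\sigma(2)\cdots\sigma(n)$ by the Robinson–Schensted correspondence lies in $\Gamma$, and let $RG(\Gamma)$ be the $R$-span of $G(\Gamma)$ in $R\,\mathrm{Sym}(n)$. Let $M(\lambda)_R$ be the permutation module of $R\,\mathrm{Sym}(n)$ on the cosets $\mathrm{Sym}(n)/\mathrm{Sym}(\lambda)$. A left $R\,\mathrm{Sym}(n)$-module $M$ is a Young permutation module of type $\Gamma$ if $M\cong\bigoplus_{\lambda\in\mathrm{Par}(n)}M(\lambda)_R^{\oplus u_\lambda}$ for some non-negative integers $u_\lambda$ such that $u_\lambda\ne0$ if and only if $\lambda\in\Gamma$. Let $\Gamma\subseteq\mathrm{Par}(n)$ be co-saturated (if $\mu\in\Gamma$ and $\mu\trianglelefteq\lambda$ then $\lambda\in\Gamma$) with a unique minimal element, let $M$ be a Young permutation module for $R\,\mathrm{Sym}(n)$ of type $\Gamma$, and let $\rho_R:R\,\mathrm{Sym}(n)\to\mathrm{End}_R(M)$ be the corresponding representation. Then: (i) The restriction $\theta_R:RG(\Gamma)\to\mathrm{End}_R(M)$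 of $\rho_R$ is injective. (ii) The annihilator $\mathrm{Ann}(M)$ of $M$ in $R\,\mathrm{Sym}(n)$ is $I_R(\Delta)^\dagger=\{d^\dagger\mid d\in I_R(\Delta)\}$, where $\Delta=\mathrm{Par}(n)\setminus\Gamma^*$. Consequently, the elements $\sigma+\mathrm{Ann}(M)$, $\sigma\in G(\Gamma)$, form an $R$-basis of $R\,\mathrm{Sym}(n)/\mathrm{Ann}(M)$. -/

import Mathlib

namespace YoungPerm

/-! ### Partitions: dominance order and transpose -/

/-- `rowSum p k = p₁ + ⋯ + p_k`, where `p₁ ≥ p₂ ≥ ⋯` are the parts of `p` in weakly decreasing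
order (and `p_i = 0` beyond the number of parts). -/
def rowSum {n : ℕ} (p : n.Partition) (k : ℕ) : ℕ :=
  ((p.parts.sort (· ≥ ·)).take k).sum

theorem list_eq_of_take_sum_eq : ∀ (l m : List ℕ), (∀ x ∈ l, 0 < x) → (∀ x ∈ m, 0 < x) →
    (∀ k, (l.take k).sum = (m.take k).sum) → l = m
  | [], [], _, _, _ => rfl
  | [], b :: m, _, hm, h => by
      have h1 := h 1
      have := hm b (by simp)
      simp at h1
      omega
  | a :: l, [], hl, _, h => by
      have h1 := h 1
      have := hl a (by simp)
      simp at h1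
      omega
  | a :: l, b :: m, hl, hm, h => by
      have hab : a = b := by simpa using h 1
      subst hab
      congr 1
      refine list_eq_of_take_sum_eq l m (fun x hx => hl x (by simp [hx]))
        (fun x hx => hm x (by simp [hx])) (fun k => ?_)
      simpa using h (k + 1)

/-- The dominance order on partitions of `n`. -/
instance dominance (n : ℕ) : PartialOrder n.Partition where
  le p q := ∀ k, rowSum p k ≤ rowSum q k
  le_refl _ _ := le_rfl
  le_trans _ _ _ h₁ h₂ k := (h₁ k).trans (h₂ k)
  le_antisymm p q h₁ h₂ := by
    have key : p.parts.sort (· ≥ ·) = q.parts.sort (· ≥ ·) :=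
      list_eq_of_take_sum_eq _ _
        (fun x hx => p.parts_pos ((Multiset.mem_sort (· ≥ ·)).1 hx))
        (fun x hx => q.parts_pos ((Multiset.mem_sort (· ≥ ·)).1 hx))
        (fun k => le_antisymm (h₁ k) (h₂ k))
    apply Nat.Partition.ext
    rw [← Multiset.sort_eq p.parts (· ≥ ·), ← Multiset.sort_eq q.parts (· ≥ ·), key]

theorem sum_range_countP (n : ℕ) (s : Multiset ℕ) (hs : ∀ x ∈ s, x ≤ n) :
    ((Multiset.range n).map (fun j => s.countP (fun x => j < x))).sum = s.sum := by
  change ∑ j ∈ Finset.range n, s.countP (fun x => j < x) = s.sum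
  induction s using Multiset.induction with
  | empty => simp
  | cons a s ih =>
    have ha : a ≤ n := hs a (by simp)
    have h2 : ∑ j ∈ Finset.range n, (if j < a then 1 else 0) = a := by
      rw [← Finset.card_filter]
      have : (Finset.range n).filter (fun j => j < a) = Finset.range a := by
        ext j
        simp only [Finset.mem_filter, Finset.mem_range]
        omega
      rw [this, Finset.card_range]
    simp only [Multiset.countP_cons, Finset.sum_add_distrib, Multiset.sum_cons]
    rw [ih (fun x hx => hs x (by simp [hx])), h2, add_comm]

/-- The dual (transpose) partition: its `j`-th part (`j = 0, 1, …`) is the number of parts of `p`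
that exceed `j`; zeros are discarded. -/
def transpose {n : ℕ} (p : n.Partition) : n.Partition :=
  Nat.Partition.ofSums n ((Multiset.range n).map (fun j => p.parts.countP (fun x => j < x)))
    ((sum_range_countP n p.parts (fun _ hx => Nat.Partition.le_of_mem_parts hx)).trans p.parts_sum)

/-! ### The Robinson–Schensted shape of a permutation -/

/-- Schensted insertion of `x` into a row: `x` replaces the first entry greater than `x`, which
is bumped out (second component), or is appended if there is none. -/
def rowInsert {α : Type*} [LinearOrder α] (x : α) : List α → List α × Option α
  | [] => ([x], none)
  | y :: ys => if x < y then (x :: ys, some y) else (y :: (rowInsert x ys).1, (rowInsert x ys).2)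

/-- Insertion of `x` into a tableau (a list of rows): the entry bumped from a row is inserted
into the next row. -/
def tableauInsert {α : Type*} [LinearOrder α] (x : α) : List (List α) → List (List α)
  | [] => [[x]]
  | r :: rs =>
    match rowInsert x r with
    | (r', none) => r' :: rs
    | (r', some y) => r' :: tableauInsert y rs

/-- The insertion tableau of a word, obtained by inserting its letters from left to right into the
empty tableau. -/
def insertionTableau {α : Type*} [LinearOrder α] (w : List α) : List (List α) :=
  w.foldl (fun T x => tableauInsert x T) []

theorem rowInsert_length {α : Type*} [LinearOrder α] (x : α) (r : List α) :
    (rowInsert x r).1.length + (rowInsert x r).2.toList.length = r.length + 1 := by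
  induction r with
  | nil => simp [rowInsert]
  | cons y ys ih =>
    unfold rowInsert
    split_ifs
    · simp
    · simp only [List.length_cons]
      omega

theorem tableauInsert_size {α : Type*} [LinearOrder α] (T : List (List α)) :
    ∀ x : α, ((tableauInsert x T).map List.length).sum = (T.map List.length).sum + 1 := by
  induction T with
  | nil => intro x; simp [tableauInsert]
  | cons r rs ih =>
    intro x
    have h := rowInsert_length x r
    unfold tableauInsert
    split
    · next r' heq =>
      rw [heq] at h
      simp at h
      simp only [List.map_cons, List.sum_cons]
      omega
    · next r' y heq =>
      rw [heq] at h
      simp at h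
      simp only [List.map_cons, List.sum_cons, ih]
      omega

theorem insertionTableau_size {α : Type*} [LinearOrder α] (w : List α) :
    ((insertionTableau w).map List.length).sum = w.length := by
  have aux : ∀ (w : List α) (T : List (List α)),
      ((w.foldl (fun T x => tableauInsert x T) T).map List.length).sum
        = (T.map List.length).sum + w.length := by
    intro w
    induction w with
    | nil => intro T; simp
    | cons x xs ih =>
      intro T
      simp only [List.foldl_cons, List.length_cons, ih, tableauInsert_size]
      omega
  simpa [insertionTableau] using aux w []

/-- The Robinson–Schensted shape of `σ`: the partition of `n` given by the row lengths of the
insertion tableau of the word `σ(1) σ(2) … σ(n)`. -/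
def rsShape {n : ℕ} (σ : Equiv.Perm (Fin n)) : n.Partition :=
  Nat.Partition.ofSums n
    (((insertionTableau (List.ofFn fun i => σ i)).map List.length : List ℕ) : Multiset ℕ)
    (by rw [Multiset.sum_coe, insertionTableau_size, List.length_ofFn])

/-- `G(Γ)`: the permutations whose Robinson–Schensted shape lies in `Γ`. -/
def permsOfShape {n : ℕ} (Γ : Set n.Partition) : Set (Equiv.Perm (Fin n)) :=
  {σ | rsShape σ ∈ Γ}

/-! ### Young subgroups, the ideals `I_R(Δ)` and the sign automorphism -/

/-- The `r`-th block of consecutive elements determined by `p` (`r = 0, 1, …`):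
`{p₁ + ⋯ + p_r + 1, …, p₁ + ⋯ + p_{r+1}}`, shifted by one because `Fin n` starts at `0`. -/
def block {n : ℕ} (p : n.Partition) (r : ℕ) : Set (Fin n) :=
  {i | rowSum p r ≤ (i : ℕ) ∧ (i : ℕ) < rowSum p (r + 1)}

/-- The Young subgroup `Sym(p)`: the permutations that preserve every block of `p`. -/
def youngSubgroup {n : ℕ} (p : n.Partition) : Subgroup (Equiv.Perm (Fin n)) where
  carrier := {σ | ∀ r i, σ i ∈ block p r ↔ i ∈ block p r}
  mul_mem' {σ τ} hσ hτ r i := (hσ r (τ i)).trans (hτ r i)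
  one_mem' _ _ := Iff.rfl
  inv_mem' {σ} hσ r i := by
    have h := hσ r (σ⁻¹ i)
    have e : σ (σ⁻¹ i) = i := Equiv.apply_symm_apply σ i
    rw [e] at h
    exact h.symm

/-- The group algebra `R Sym(n)`. -/
abbrev SymAlg (R : Type*) [CommRing R] (n : ℕ) : Type _ :=
  MonoidAlgebra R (Equiv.Perm (Fin n))

open Classical in
/-- `[H] = ∑_{h ∈ H} h` for `H = Sym(p)`. -/
noncomputable def youngSum (R : Type*) [CommRing R] {n : ℕ} (p : n.Partition) : SymAlg R n :=
  ∑ σ : Equiv.Perm (Fin n) with σ ∈ youngSubgroup p, MonoidAlgebra.of R _ σ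

/-- `I_R(Δ)`: the two-sided ideal of `R Sym(n)` generated by the `[Sym(p)]`, `p ∈ Δ`. -/
noncomputable def youngIdeal (R : Type*) [CommRing R] {n : ℕ} (Δ : Set n.Partition) :
    TwoSidedIdeal (SymAlg R n) :=
  TwoSidedIdeal.span (youngSum R '' Δ)

/-- The algebra endomorphism `†` of `R Sym(n)` (in fact an automorphism) given by
`σ ↦ sgn(σ) σ`. -/
noncomputable def dagger (R : Type*) [CommRing R] (n : ℕ) : SymAlg R n →ₐ[R] SymAlg R n :=
  MonoidAlgebra.lift R (SymAlg R n) (Equiv.Perm (Fin n))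
    { toFun := fun σ => ((Equiv.Perm.sign σ : ℤˣ) : ℤ) • MonoidAlgebra.of R _ σ
      map_one' := by rw [map_one, map_one, Units.val_one, one_smul]
      map_mul' := fun σ τ => by
        rw [map_mul, map_mul, Units.val_mul, smul_mul_smul_comm] }

/-- `R G(Γ)`: the `R`-span of `G(Γ)` in `R Sym(n)`. -/
noncomputable def shapeSpan (R : Type*) [CommRing R] {n : ℕ} (Γ : Set n.Partition) :
    Submodule R (SymAlg R n) :=
  Submodule.span R (MonoidAlgebra.of R (Equiv.Perm (Fin n)) '' permsOfShape Γ)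

/-! ### Young permutation modules -/

/-- `M(p)_R`: the permutation module of `R Sym(n)` on the cosets `Sym(n)/Sym(p)`. -/
abbrev PermModule (R : Type*) [CommRing R] {n : ℕ} (p : n.Partition) : Type _ :=
  (Representation.ofMulAction R (Equiv.Perm (Fin n))
    (Equiv.Perm (Fin n) ⧸ youngSubgroup p)).asModule

open scoped DirectSum in
/-- `M` is a Young permutation module of type `Γ`: it is isomorphic to `⨁ₚ M(p)^{u_p}` for some
multiplicities `u_p`, with `u_p ≠ 0` exactly for `p ∈ Γ`. -/
def IsYoungPermModuleOfType (R : Type*) [CommRing R] {n : ℕ} (Γ : Set n.Partition)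
    (M : Type*) [AddCommGroup M] [Module (SymAlg R n) M] : Prop :=
  ∃ u : n.Partition → ℕ, (∀ p, u p ≠ 0 ↔ p ∈ Γ) ∧
    Nonempty (M ≃ₗ[SymAlg R n] ⨁ p : n.Partition, (Fin (u p) → PermModule R p))

end YoungPerm

/-! Since `Par(n)` is finite, a co-saturated `Γ` with a unique minimal element `μ` is `{q | μ ≤ q}`.
Write `A` for `Ann(M)` and `J` for `I_R(Δ)^†`. All three claims follow from `J ⊆ A`, `RG(Γ) + J = R
Sym(n)` and `RG(Γ) ∩ A = 0`.

Inclusion (`dagger_mem_annihilator`). The signed sum over `Sym(p)` kills `M(q)` unless `q ≤ p*`: if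
a transposition preserves both the blocks of `p` and the row function of a coset, the terms cancel
in pairs. For `q ∈ Γ`, `q ≤ p*` puts `p*` in `Γ`, so `p ∉ Δ`.

Spanning (`of_mem_sup`). If the shape of `σ` does not dominate `μ`, it has more boxes than `μ` in
the first `k` columns, for some `k`. By one half of Greene's theorem (`exists_decreasing_colouring`)
as many letters of `σ` are covered by `k` disjoint decreasing subsequences. The signed sum over the
permutations of positions preserving these subsequences lies in `J`. Multiplying `σ` by it gives `σ`
plus signed permutations whose words are lexicographically smaller, so induction applies.

Independence (`eq_zero_of_smul_permModule_eq_zero`). To `σ` belong a matrix coefficient `rsCoeff` of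
`M(rsShape σ)`, given by the rows of its recording and insertion tableaux, and an element
`rsElement`, given also by their columns. These pair unitriangularly for dominance of row functions,
because the Robinson–Schensted correspondence is injective. Hence the coefficients with `σ ∈ G(Γ)`
map `R Sym(n)` onto `R^G(Γ)`. They vanish on `A`, hence on `J`, so by spanning they already map
`RG(Γ)` onto `R^G(Γ)`. Composing with `R^G(Γ) → RG(Γ)` gives a surjective endomorphism of a finitely
generated module over a commutative ring, which is injective; so no nontrivial combination of `G(Γ)`
lies in `A`. -/

namespace YoungPerm

/-! ### Parts, row sums and column sums -/

/-- The `i`-th part of `p` (`i = 0, 1, …`) in weakly decreasing order, `0` beyond the last one. -/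
def part {n : ℕ} (p : n.Partition) (i : ℕ) : ℕ := (p.parts.sort (· ≥ ·)).getD i 0

/-- The number of boxes of the diagram of `p` in the first `k` columns. -/
def colSum {n : ℕ} (p : n.Partition) (k : ℕ) : ℕ := (p.parts.map (min k)).sum

theorem sum_take_eq_sum_getD (l : List ℕ) (k : ℕ) :
    (l.take k).sum = ∑ i ∈ Finset.range k, l.getD i 0 := by
  induction l generalizing k with
  | nil => simp
  | cons a l ih =>
    cases k with
    | zero => simp
    | succ k => simp [Finset.sum_range_succ', ih, add_comm]

theorem rowSum_eq_sum_part {n : ℕ} (p : n.Partition) (k : ℕ) :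
    rowSum p k = ∑ i ∈ Finset.range k, part p i :=
  sum_take_eq_sum_getD _ _

theorem getD_antitone_of_pairwise {l : List ℕ} (h : l.Pairwise (· ≥ ·)) :
    Antitone (fun i => l.getD i 0) := by
  intro i j hij
  rcases hij.eq_or_lt with rfl | hlt
  · exact le_rfl
  by_cases hj : j < l.length
  · simp only [List.getD_eq_getElem _ _ hj, List.getD_eq_getElem _ _ (hlt.trans hj)]
    exact List.pairwise_iff_getElem.1 h i j _ _ hlt
  · simp only [List.getD_eq_default _ _ (not_lt.1 hj)]
    exact Nat.zero_le _

theorem part_antitone {n : ℕ} (p : n.Partition) : Antitone (part p) :=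
  getD_antitone_of_pairwise (Multiset.pairwise_sort _ _)

theorem card_parts_le {n : ℕ} (p : n.Partition) : p.parts.card ≤ n := by
  have h := Multiset.card_nsmul_le_sum (s := p.parts) (a := 1) (fun x hx => p.parts_pos hx)
  rw [p.parts_sum] at h
  simpa using h

theorem part_eq_zero {n : ℕ} (p : n.Partition) {i : ℕ} (hi : n ≤ i) : part p i = 0 := by
  unfold part
  rw [List.getD_eq_default]
  rw [Multiset.length_sort]
  exact (card_parts_le p).trans hi

theorem sum_map_eq_sum_getD (l : List ℕ) (F : ℕ → ℕ) (hF : F 0 = 0) {N : ℕ}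
    (hN : l.length ≤ N) : (l.map F).sum = ∑ i ∈ Finset.range N, F (l.getD i 0) := by
  induction l generalizing N with
  | nil => simp [hF]
  | cons a l ih =>
    cases N with
    | zero => simp at hN
    | succ N =>
      have := ih (N := N) (by simpa using hN)
      simp [Finset.sum_range_succ', this, add_comm]

theorem sum_map_parts {n : ℕ} (p : n.Partition) (F : ℕ → ℕ) (hF : F 0 = 0) {N : ℕ}
    (hN : n ≤ N) : (p.parts.map F).sum = ∑ i ∈ Finset.range N, F (part p i) := by
  have h : p.parts.map F = (((p.parts.sort (· ≥ ·)).map F : List ℕ) : Multiset ℕ) := by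
    rw [← Multiset.map_coe, Multiset.sort_eq]
  rw [h, Multiset.sum_coe]
  refine sum_map_eq_sum_getD _ _ hF ?_
  rw [Multiset.length_sort]
  exact (card_parts_le p).trans hN

theorem sum_part {n : ℕ} (p : n.Partition) {N : ℕ} (hN : n ≤ N) :
    ∑ i ∈ Finset.range N, part p i = n := by
  have h := sum_map_parts p id rfl hN
  rw [Multiset.map_id, p.parts_sum] at h
  exact h.symm

theorem rowSum_eq_self {n : ℕ} (p : n.Partition) {N : ℕ} (hN : n ≤ N) : rowSum p N = n := by
  rw [rowSum_eq_sum_part, sum_part p hN]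

theorem part_le {n : ℕ} (p : n.Partition) (i : ℕ) : part p i ≤ n := by
  have h := Finset.single_le_sum (f := part p) (fun _ _ => Nat.zero_le _)
    (Finset.mem_range.2 (show i < n + i + 1 by omega))
  rwa [sum_part p (by omega)] at h

/-- Each part splits as `x = min k x + (x - k)`. The truncated sum, the excess over `k`, links
column sums to row sums below. -/
theorem colSum_add_excess {n : ℕ} (p : n.Partition) (k : ℕ) {N : ℕ} (hN : n ≤ N) :
    colSum p k + ∑ i ∈ Finset.range N, (part p i - k) = n := by
  unfold colSum
  rw [sum_map_parts p (min k) (by simp) hN, ← Finset.sum_add_distrib]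
  conv_rhs => rw [← sum_part p hN]
  exact Finset.sum_congr rfl fun i _ => by omega

/-- A form of convex duality: this bound holds for all `j` and `k`, and `rowSum_eq_excess` gives
equality when `k` separates the first `j` parts from the rest. Using equality for one partition and
the bound for the other shows that transposition reverses dominance. -/
theorem rowSum_le_excess {n : ℕ} (p : n.Partition) (j k : ℕ) {N : ℕ} (hN : j ≤ N) :
    rowSum p j ≤ j * k + ∑ i ∈ Finset.range N, (part p i - k) := by
  rw [rowSum_eq_sum_part]
  calc ∑ i ∈ Finset.range j, part p i
      ≤ ∑ i ∈ Finset.range j, (k + (part p i - k)) :=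
        Finset.sum_le_sum fun i _ => by omega
    _ = j * k + ∑ i ∈ Finset.range j, (part p i - k) := by simp [Finset.sum_add_distrib]
    _ ≤ _ := by
        gcongr

theorem rowSum_eq_excess {n : ℕ} (p : n.Partition) {j k : ℕ} {N : ℕ} (hN : j ≤ N)
    (h₁ : ∀ i < j, k ≤ part p i) (h₂ : ∀ i, j ≤ i → part p i ≤ k) :
    rowSum p j = j * k + ∑ i ∈ Finset.range N, (part p i - k) := by
  rw [rowSum_eq_sum_part]
  have e : ∑ i ∈ Finset.range N, (part p i - k) = ∑ i ∈ Finset.range j, (part p i - k) := by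
    symm
    refine Finset.sum_subset (by simpa using hN) fun i _ hi => ?_
    have := h₂ i (by simpa using hi)
    omega
  have e' : j * k = ∑ i ∈ Finset.range j, k := by simp
  rw [e, e', ← Finset.sum_add_distrib]
  refine Finset.sum_congr rfl fun i hi => ?_
  have := h₁ i (by simpa using hi)
  omega

theorem colSum_le_of_le {n : ℕ} {p q : n.Partition} (h : p ≤ q) (k : ℕ) :
    colSum q k ≤ colSum p k := by
  classical
  have hex : ∃ j, part p j ≤ k := ⟨n, by simp [part_eq_zero p le_rfl]⟩
  -- `j` is the number of parts of `p` exceeding `k`, so the bound is sharp for `p` at `(j, k)`.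
  set j := Nat.find hex with hj
  have h1 := rowSum_eq_excess p (j := j) (k := k) (N := n + j) (by omega)
    (fun i hi => (not_le.1 (Nat.find_min hex hi)).le)
    (fun i hi => (part_antitone p hi).trans (Nat.find_spec hex))
  have h2 := rowSum_le_excess q j k (N := n + j) (by omega)
  have h3 := colSum_add_excess p k (N := n + j) (by omega)
  have h4 := colSum_add_excess q k (N := n + j) (by omega)
  have h5 : rowSum p j ≤ rowSum q j := h j
  omega

theorem le_of_colSum_le {n : ℕ} {p q : n.Partition} (h : ∀ k, colSum q k ≤ colSum p k) :
    p ≤ q := by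
  intro j
  -- Here `j` is given, and `k = part q j` makes the bound sharp for `q`.
  have h1 := rowSum_eq_excess q (j := j) (k := part q j) (N := n + j) (by omega)
    (fun i hi => part_antitone q hi.le) (fun i hi => part_antitone q hi)
  have h2 := rowSum_le_excess p j (part q j) (N := n + j) (by omega)
  have h3 := colSum_add_excess p (part q j) (N := n + j) (by omega)
  have h4 := colSum_add_excess q (part q j) (N := n + j) (by omega)
  have h5 := h (part q j)
  omega

/-- In a weakly decreasing list the zeros come last, so discarding them, as `Nat.Partition.ofSums`
does, shifts no index. -/
theorem getD_filter_ne_zero {l : List ℕ} (h : l.Pairwise (· ≥ ·)) (i : ℕ) :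
    (l.filter (fun x => decide (x ≠ 0))).getD i 0 = l.getD i 0 := by
  induction l generalizing i with
  | nil => simp
  | cons a l ih =>
    rw [List.pairwise_cons] at h
    by_cases ha : a = 0
    · subst ha
      have h0 : ∀ x ∈ l, x = 0 := fun x hx => Nat.le_zero.1 (h.1 x hx)
      have hf : (0 :: l).filter (fun x => decide (x ≠ 0)) = [] := by
        rw [List.filter_eq_nil_iff]
        intro x hx
        rcases List.mem_cons.1 hx with rfl | hx
        · simp
        · simp [h0 x hx]
      rw [hf]
      by_cases hi : i < (0 :: l).length
      · rw [List.getD_eq_getElem _ _ hi]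
        have := List.getElem_mem hi
        rcases List.mem_cons.1 this with e | e
        · rw [e]; simp
        · rw [h0 _ e]; simp
      · rw [List.getD_eq_default _ _ (not_lt.1 hi)]; simp
    · rw [List.filter_cons_of_pos (by simpa using ha)]
      cases i with
      | zero => simp
      | succ i => simpa using ih h.2 i

theorem part_ofSums {n : ℕ} {l : List ℕ} (h : l.Pairwise (· ≥ ·)) (hl : (l : Multiset ℕ).sum = n)
    (i : ℕ) : part (Nat.Partition.ofSums n l hl) i = l.getD i 0 := by
  unfold part
  have e : (Nat.Partition.ofSums n l hl).parts.sort (· ≥ ·) =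
      l.filter (fun x => decide (x ≠ 0)) := by
    rw [Nat.Partition.ofSums_parts, Multiset.filter_coe, Multiset.coe_sort,
      List.mergeSort_of_pairwise]
    simpa using h.filter _
  rw [e, getD_filter_ne_zero h]

theorem part_transpose {n : ℕ} (p : n.Partition) (j : ℕ) :
    part (transpose p) j = p.parts.countP (fun x => j < x) := by
  have hs : ((List.range n).map (fun j => p.parts.countP (fun x => j < x))).Pairwise (· ≥ ·) := by
    rw [List.pairwise_map]
    refine List.pairwise_lt_range.imp fun {a b} hab => ?_
    simp only [Multiset.countP_eq_card_filter]
    exact Multiset.card_le_card (Multiset.monotone_filter_right _ fun x hx => by omega)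
  have h := part_ofSums hs (n := n)
    ((sum_range_countP n p.parts (fun _ hx => Nat.Partition.le_of_mem_parts hx)).trans p.parts_sum) j
  change part (transpose p) j = _ at h
  rw [h]
  by_cases hj : j < n
  · rw [List.getD_eq_getElem _ _ (by simpa using hj)]
    simp
  · rw [List.getD_eq_default _ _ (by simpa using hj)]
    symm
    rw [Multiset.countP_eq_zero]
    intro x hx
    have := Nat.Partition.le_of_mem_parts hx
    omega

theorem sum_range_ite_lt (x k : ℕ) : ∑ j ∈ Finset.range k, (if j < x then 1 else 0) = min k x := by
  rw [← Finset.card_filter]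
  have : (Finset.range k).filter (fun j => j < x) = Finset.range (min k x) := by
    ext j
    simp only [Finset.mem_filter, Finset.mem_range]
    omega
  rw [this, Finset.card_range]

theorem rowSum_transpose {n : ℕ} (p : n.Partition) (k : ℕ) :
    rowSum (transpose p) k = colSum p k := by
  rw [rowSum_eq_sum_part]
  simp only [part_transpose]
  unfold colSum
  induction p.parts using Multiset.induction with
  | empty => simp
  | cons a s ih =>
    simp only [Multiset.countP_cons, Finset.sum_add_distrib, Multiset.map_cons, Multiset.sum_cons,
      ih, sum_range_ite_lt]
    exact add_comm _ _

theorem countP_parts {n : ℕ} (p : n.Partition) (j : ℕ) {N : ℕ} (hN : n ≤ N) :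
    p.parts.countP (fun x => j < x) = ∑ i ∈ Finset.range N, (if j < part p i then 1 else 0) := by
  rw [← sum_map_parts p (fun x => if j < x then 1 else 0) (by simp) hN]
  induction p.parts using Multiset.induction with
  | empty => simp
  | cons a s ih => simp only [Multiset.countP_cons, Multiset.map_cons, Multiset.sum_cons, ih,
      add_comm]

theorem colSum_transpose {n : ℕ} (p : n.Partition) (k : ℕ) :
    colSum (transpose p) k = rowSum p k := by
  unfold colSum
  rw [sum_map_parts _ (min k) (by simp) le_rfl, rowSum_eq_sum_part]
  have h : ∀ j, min k (part (transpose p) j)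
      = ∑ i ∈ Finset.range k, (if j < part p i then 1 else 0) := by
    intro j
    rw [part_transpose, countP_parts p j (N := n + k) (by omega)]
    -- The rows longer than `j` form an initial segment, of length `m` say; both sides then equal
    -- `min k m`, and the claim becomes a double count of the boxes in the first `k` rows.
    have hex : ∃ m, ∀ i, j < part p i ↔ i < m := by
      classical
      have hex : ∃ i, part p i ≤ j := ⟨n, by simp [part_eq_zero p le_rfl]⟩
      refine ⟨Nat.find hex, fun i => ⟨fun hi => ?_, fun hi => not_le.1 (Nat.find_min hex hi)⟩⟩
      by_contra hc
      exact absurd ((part_antitone p (not_lt.1 hc)).trans (Nat.find_spec hex)) (not_le.2 hi)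
    obtain ⟨m, hm⟩ := hex
    have hmn : m ≤ n := by
      by_contra hc
      have := (hm n).2 (by omega)
      rw [part_eq_zero p le_rfl] at this
      omega
    simp only [hm, sum_range_ite_lt]
    omega
  simp only [h]
  rw [Finset.sum_comm]
  refine Finset.sum_congr rfl fun i _ => ?_
  rw [sum_range_ite_lt]
  exact min_eq_right (part_le p i)

theorem eq_of_rowSum_eq {n : ℕ} {p q : n.Partition} (h : ∀ k, rowSum p k = rowSum q k) : p = q :=
  le_antisymm (fun k => (h k).le) (fun k => (h k).ge)

theorem transpose_transpose {n : ℕ} (p : n.Partition) : transpose (transpose p) = p :=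
  eq_of_rowSum_eq fun k => by rw [rowSum_transpose, colSum_transpose]

/-! ### The block function of a partition -/

theorem rowSum_mono {n : ℕ} (p : n.Partition) : Monotone (rowSum p) := by
  intro a b hab
  rw [rowSum_eq_sum_part, rowSum_eq_sum_part]
  exact Finset.sum_le_sum_of_subset (by simpa using hab)

theorem exists_lt_rowSum {n : ℕ} (p : n.Partition) (i : Fin n) : ∃ r, (i : ℕ) < rowSum p (r + 1) :=
  ⟨n, by rw [rowSum_eq_self p (by omega)]; exact i.2⟩

/-- The index of the block of `p` that contains `i`. -/
def blockIndex {n : ℕ} (p : n.Partition) (i : Fin n) : ℕ := Nat.find (exists_lt_rowSum p i)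

theorem mem_block_iff {n : ℕ} (p : n.Partition) (i : Fin n) (r : ℕ) :
    i ∈ block p r ↔ blockIndex p i = r := by
  unfold blockIndex
  rw [Nat.find_eq_iff]
  constructor
  · rintro ⟨h1, h2⟩
    refine ⟨h2, fun m hm => ?_⟩
    have := rowSum_mono p (show m + 1 ≤ r by omega)
    omega
  · rintro ⟨h1, h2⟩
    refine ⟨?_, h1⟩
    cases r with
    | zero => simp [rowSum]
    | succ r => exact not_lt.1 (h2 r (by omega))

theorem mem_youngSubgroup_iff {n : ℕ} (p : n.Partition) (σ : Equiv.Perm (Fin n)) :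
    σ ∈ youngSubgroup p ↔ ∀ i, blockIndex p (σ i) = blockIndex p i := by
  change (∀ r i, σ i ∈ block p r ↔ i ∈ block p r) ↔ _
  simp only [mem_block_iff]
  constructor
  · intro h i
    exact (h _ i).2 rfl
  · intro h r i
    rw [h i]

theorem card_blockIndex_eq {n : ℕ} (p : n.Partition) (r : ℕ) :
    (Finset.univ.filter fun i => blockIndex p i = r).card = part p r := by
  have h : (Finset.univ.filter fun i => blockIndex p i = r).card
      = (Finset.Ico (rowSum p r) (rowSum p (r + 1))).card := by
    refine Finset.card_bij (fun i _ => (i : ℕ)) ?_ ?_ ?_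
    · intro i hi
      simp only [Finset.mem_filter, Finset.mem_univ, true_and, ← mem_block_iff] at hi
      exact Finset.mem_Ico.2 hi
    · intro i _ j _ hij
      exact Fin.ext hij
    · intro m hm
      rw [Finset.mem_Ico] at hm
      have : rowSum p (r + 1) ≤ n := by
        have h1 := rowSum_mono p (show r + 1 ≤ n + r + 1 by omega)
        rwa [rowSum_eq_self p (by omega : n ≤ n + r + 1)] at h1
      refine ⟨⟨m, by omega⟩, ?_, rfl⟩
      simp only [Finset.mem_filter, Finset.mem_univ, true_and, ← mem_block_iff]
      exact hm
  rw [h, Nat.card_Ico, rowSum_eq_sum_part, rowSum_eq_sum_part, Finset.sum_range_succ]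
  omega

/-- Two functions with equinumerous fibres differ by a permutation of their domain. -/
theorem exists_perm_comp_eq {α κ : Type*} [Fintype α] [DecidableEq κ] (f g : α → κ)
    (h : ∀ r, (Finset.univ.filter fun i => f i = r).card =
      (Finset.univ.filter fun i => g i = r).card) :
    ∃ e : Equiv.Perm α, ∀ i, g (e i) = f i := by
  have h' : ∀ r, Nonempty ({i // f i = r} ≃ {i // g i = r}) := fun r => by
    rw [← Fintype.card_eq, Fintype.card_subtype, Fintype.card_subtype]
    exact h r
  let E : ∀ r, {i // f i = r} ≃ {i // g i = r} := fun r => (h' r).some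
  refine ⟨(Equiv.sigmaFiberEquiv f).symm.trans ((Equiv.sigmaCongrRight E).trans
    (Equiv.sigmaFiberEquiv g)), fun i => ?_⟩
  exact (E (f i) ⟨i, rfl⟩).2

/-- A submultiset of the parts with at most `k` elements has sum at most `p₁ + ⋯ + p_k`. -/
theorem sum_le_rowSum {n : ℕ} (p : n.Partition) (s : Multiset ℕ) (hs : s ≤ p.parts) {k : ℕ}
    (hk : s.card ≤ k) : s.sum ≤ rowSum p k := by
  -- With threshold `part p k` the row sum is exactly `k` times the threshold plus the total excess;
  -- a submultiset with at most `k` members has no more of either.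
  have h1 := rowSum_eq_excess p (j := k) (k := part p k) (N := n + k) (by omega)
    (fun i hi => part_antitone p hi.le) (fun i hi => part_antitone p hi)
  rw [← sum_map_parts p (fun x => x - part p k) (by simp) (by omega)] at h1
  have h2 : (s.map (fun x => x - part p k)).sum ≤ (p.parts.map (fun x => x - part p k)).sum := by
    obtain ⟨u, hu⟩ := Multiset.le_iff_exists_add.1 hs
    rw [hu, Multiset.map_add, Multiset.sum_add]
    exact Nat.le_add_right _ _
  have h3 : s.sum ≤ s.card * part p k + (s.map (fun x => x - part p k)).sum := by
    clear hs hk h2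
    induction s using Multiset.induction with
    | empty => simp
    | cons a s ih =>
      simp only [Multiset.sum_cons, Multiset.card_cons, Multiset.map_cons, add_mul]
      omega
  have h4 : s.card * part p k ≤ k * part p k := Nat.mul_le_mul_right _ hk
  omega

/-- `p` is the list of fibre sizes of `f` in decreasing order, and `g` carries the blocks of `p` to
the fibres. At most `k` fibres have colour `< k`, so their union is no larger than the first `k`
rows. -/
theorem exists_partition_of_fun {n : ℕ} (f : Fin n → ℕ) : ∃ (p : n.Partition)
    (g : Equiv.Perm (Fin n)), (∀ i j, f (g i) = f (g j) ↔ blockIndex p i = blockIndex p j) ∧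
      ∀ k, (Finset.univ.filter fun i => f i < k).card ≤ rowSum p k := by
  classical
  let size : ℕ → ℕ := fun c => (Finset.univ.filter fun i => f i = c).card
  have hsum : (((Finset.univ.image f).val.map size)).sum = n := by
    have := Finset.card_eq_sum_card_image f (Finset.univ : Finset (Fin n))
    rw [Finset.card_univ, Fintype.card_fin] at this
    exact this.symm
  -- The values of `f`, largest fibre first: the position of a value in `l` is the index of the
  -- block matched with its fibre.
  let l : List ℕ := (Finset.univ.image f).toList.insertionSort (fun a b => size a ≥ size b)
  have : Std.Total (fun a b : ℕ => size a ≥ size b) := ⟨fun a b => le_total _ _⟩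
  have : IsTrans ℕ (fun a b : ℕ => size a ≥ size b) := ⟨fun a b c h1 h2 => le_trans h2 h1⟩
  have hperm : l.Perm (Finset.univ.image f).toList := List.perm_insertionSort _ _
  have hnodup : l.Nodup := hperm.nodup_iff.2 (Finset.nodup_toList _)
  have hmem : ∀ i, f i ∈ l := fun i => hperm.mem_iff.2 (by simp)
  have hsorted : (l.map size).Pairwise (· ≥ ·) := by
    rw [List.pairwise_map]
    exact List.pairwise_insertionSort (fun a b => size a ≥ size b) _
  have hcoe : ((l.map size : List ℕ) : Multiset ℕ) = (Finset.univ.image f).val.map size := by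
    rw [← Multiset.map_coe, Multiset.coe_eq_coe.2 hperm, Finset.coe_toList]
  have hls : ((l.map size : List ℕ) : Multiset ℕ).sum = n := by rw [hcoe, hsum]
  have hinj : ∀ i j, l.idxOf (f i) = l.idxOf (f j) ↔ f i = f j := fun i j =>
    List.idxOf_inj (hmem i)
  let p := Nat.Partition.ofSums n _ hls
  have hparts : p.parts = (Finset.univ.image f).val.map size := by
    change Multiset.filter (fun x => x ≠ 0) ((l.map size : List ℕ) : Multiset ℕ) = _
    rw [hcoe, Multiset.filter_eq_self]
    intro x hx
    rw [Multiset.mem_map] at hx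
    obtain ⟨c, hc, rfl⟩ := hx
    obtain ⟨i, -, rfl⟩ := Finset.mem_image.1 (show c ∈ Finset.univ.image f from hc)
    exact Finset.card_ne_zero_of_mem (a := i) (by simp)
  obtain ⟨g, hg⟩ := exists_perm_comp_eq (blockIndex p) (fun i => l.idxOf (f i)) (fun r => by
    rw [card_blockIndex_eq, part_ofSums hsorted]
    by_cases hr : r < l.length
    · rw [List.getD_eq_getElem _ _ (by simpa using hr), List.getElem_map]
      refine congrArg Finset.card (Finset.filter_congr fun i _ => ?_)
      constructor
      · intro h
        rw [h]
        exact hnodup.idxOf_getElem r hr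
      · rintro rfl
        simp
    · rw [List.getD_eq_default _ _ (by simpa using hr)]
      symm
      rw [Finset.card_eq_zero, Finset.filter_eq_empty_iff]
      intro i _ h
      exact hr (h ▸ List.idxOf_lt_length_iff.2 (hmem i)))
  refine ⟨p, g, fun i j => ?_, fun k => ?_⟩
  · rw [← hg, ← hg, hinj]
  · let s : Multiset ℕ := ((Finset.univ.image f).filter (· < k)).val.map size
    have h1 : s ≤ p.parts := by
      rw [hparts]
      exact Multiset.map_le_map (Finset.val_le_iff.2 (Finset.filter_subset _ _))
    have h2 : s.card ≤ k := by
      rw [Multiset.card_map]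
      have : (Finset.univ.image f).filter (· < k) ⊆ Finset.range k := by
        intro x hx
        simpa using (Finset.mem_filter.1 hx).2
      exact (Finset.card_le_card this).trans_eq (Finset.card_range k)
    have h3 : s.sum = (Finset.univ.filter fun i => f i < k).card := by
      rw [Finset.card_eq_sum_card_fiberwise (f := f) (t := (Finset.univ.image f).filter (· < k))]
      · refine Finset.sum_congr rfl fun c hc => ?_
        rw [Finset.filter_filter]
        refine congrArg Finset.card (Finset.filter_congr fun i _ => ?_)
        have := (Finset.mem_filter.1 hc).2
        constructor
        · intro h; exact ⟨h ▸ this, h⟩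
        · exact fun h => h.2
      · intro i hi
        simpa using hi
    rw [← h3]
    exact sum_le_rowSum p s h1 h2


/-! ### Semistandard tableaux and Schensted insertion -/

section Insertion

variable {α : Type*} [LinearOrder α]

/-- `Below r s`: the row `s` is not longer than `r` and each of its entries exceeds the entry
of `r` above it. -/
def Below : List α → List α → Prop
  | _, [] => True
  | [], _ :: _ => False
  | a :: r, b :: s => a < b ∧ Below r s

theorem below_nil (r : List α) : Below r [] := by cases r <;> trivial

/-- Lists of rows that form a semistandard tableau. -/
def IsTableau (T : List (List α)) : Prop :=
  (∀ r ∈ T, r.Pairwise (· ≤ ·)) ∧ T.IsChain Below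

theorem Below.getElem? {r s : List α} (h : Below r s) {j : ℕ} {b : α} (hb : s[j]? = some b) :
    ∃ a, r[j]? = some a ∧ a < b := by
  induction r generalizing s j with
  | nil =>
    cases s with
    | nil => simp at hb
    | cons _ _ => exact h.elim
  | cons a r ih =>
    cases s with
    | nil => simp at hb
    | cons b' s =>
      cases j with
      | zero =>
        simp only [List.getElem?_cons_zero, Option.some.injEq] at hb
        exact ⟨a, by simp, hb ▸ h.1⟩
      | succ j => simpa using ih h.2 (by simpa using hb)

theorem Below.length_le {r s : List α} (h : Below r s) : s.length ≤ r.length := by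
  induction r generalizing s with
  | nil =>
    cases s with
    | nil => simp
    | cons _ _ => exact h.elim
  | cons a r ih =>
    cases s with
    | nil => simp
    | cons b' s => simpa using ih h.2

theorem Below.trans {r s t : List α} (h : Below r s) (h' : Below s t) : Below r t := by
  induction r generalizing s t with
  | nil =>
    cases s with
    | nil => exact h'
    | cons _ _ => exact h.elim
  | cons a r ih =>
    cases t with
    | nil => trivial
    | cons c t =>
      cases s with
      | nil => exact h'.elim
      | cons b s => exact ⟨h.1.trans h'.1, ih h.2 h'.2⟩

theorem lt_of_rowInsert_eq_some {x y : α} {r : List α} (h : (rowInsert x r).2 = some y) :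
    x < y ∧ y ∈ r := by
  induction r with
  | nil => simp [rowInsert] at h
  | cons a r ih =>
    unfold rowInsert at h
    split_ifs at h with hx
    · simp only [Option.some.injEq] at h
      subst h
      exact ⟨hx, by simp⟩
    · have := ih h
      exact ⟨this.1, List.mem_cons_of_mem _ this.2⟩

theorem mem_rowInsert_self (x : α) (r : List α) : x ∈ (rowInsert x r).1 := by
  induction r with
  | nil => simp [rowInsert]
  | cons a r ih =>
    unfold rowInsert
    split_ifs with hx
    · simp
    · exact List.mem_cons_of_mem _ ih

theorem perm_rowInsert (x : α) (r : List α) :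
    ((rowInsert x r).2.toList ++ (rowInsert x r).1).Perm (x :: r) := by
  induction r with
  | nil => simp [rowInsert]
  | cons a r ih =>
    unfold rowInsert
    split_ifs with hx
    · simpa using List.Perm.swap _ _ _
    · exact List.perm_middle.trans ((ih.cons a).trans (List.Perm.swap _ _ _))

theorem mem_of_mem_rowInsert {x z : α} {r : List α} (h : z ∈ (rowInsert x r).1) :
    z = x ∨ z ∈ r := by
  have := (perm_rowInsert x r).mem_iff.1 (List.mem_append_right _ h)
  simpa using this

theorem rowInsert_pairwise {x : α} {r : List α} (h : r.Pairwise (· ≤ ·)) :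
    (rowInsert x r).1.Pairwise (· ≤ ·) := by
  induction r with
  | nil => simp [rowInsert]
  | cons a r ih =>
    rw [List.pairwise_cons] at h
    unfold rowInsert
    split_ifs with hx
    · exact List.pairwise_cons.2 ⟨fun z hz => hx.le.trans (h.1 z hz), h.2⟩
    · refine List.pairwise_cons.2 ⟨fun z hz => ?_, ih h.2⟩
      rcases mem_of_mem_rowInsert hz with rfl | hz
      · exact not_lt.1 hx
      · exact h.1 z hz

/-- Row insertion replaces an entry by a smaller one or appends; neither disturbs the row
underneath. -/
theorem Below.rowInsert_left {r s : List α} (h : Below r s) (x : α) :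
    Below (rowInsert x r).1 s := by
  induction r generalizing s with
  | nil =>
    cases s with
    | nil => trivial
    | cons _ _ => exact h.elim
  | cons a r ih =>
    cases s with
    | nil => exact below_nil _
    | cons b s =>
      unfold rowInsert
      split_ifs with hx
      · exact ⟨hx.trans h.1, h.2⟩
      · exact ⟨h.1, ih h.2⟩

/-- The entry of `s` under the box vacated by `y`, if any, exceeds `y`. So `y` enters `s` in that
column or further left, where the entries of the new upper row are at most `x < y`. -/
theorem Below.rowInsert_bumped {r s : List α} (h : Below r s) (hr : r.Pairwise (· ≤ ·)) {x y : α}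
    (hy : (rowInsert x r).2 = some y) : Below (rowInsert x r).1 (rowInsert y s).1 := by
  induction r generalizing s with
  | nil => simp [rowInsert] at hy
  | cons a r ih =>
    rw [List.pairwise_cons] at hr
    unfold rowInsert at hy
    rw [rowInsert.eq_def x (a :: r)]
    dsimp only
    split_ifs at hy ⊢ with hx
    · simp only [Option.some.injEq] at hy
      subst hy
      cases s with
      | nil => exact ⟨hx, below_nil _⟩
      | cons b s =>
        unfold rowInsert
        rw [if_pos h.1]
        exact ⟨hx, h.2⟩
    · have hxy := (lt_of_rowInsert_eq_some hy).1
      have hay : a < y := (not_lt.1 hx).trans_lt hxy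
      cases s with
      | nil => exact ⟨hay, below_nil _⟩
      | cons b s =>
        rw [rowInsert.eq_def y (b :: s)]
        dsimp only
        split_ifs with hyb
        · exact ⟨hay, h.2.rowInsert_left x⟩
        · exact ⟨h.1, ih h.2 hr.2 hy⟩

theorem tableauInsert_cons_none {x : α} {r : List α} (rs : List (List α))
    (h : (rowInsert x r).2 = none) : tableauInsert x (r :: rs) = (rowInsert x r).1 :: rs := by
  unfold tableauInsert
  split
  · next heq => rw [heq]
  · next heq => rw [heq] at h; simp at h

theorem tableauInsert_cons_some {x y : α} {r : List α} (rs : List (List α))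
    (h : (rowInsert x r).2 = some y) :
    tableauInsert x (r :: rs) = (rowInsert x r).1 :: tableauInsert y rs := by
  rw [tableauInsert.eq_def x (r :: rs)]
  dsimp only
  split
  · next heq => rw [heq] at h; simp at h
  · next heq =>
    rw [heq] at h
    simp only [Option.some.injEq] at h
    rw [heq, h]

theorem isTableau_cons {r : List α} {T : List (List α)} :
    IsTableau (r :: T) ↔ r.Pairwise (· ≤ ·) ∧ (∀ s ∈ T.head?, Below r s) ∧ IsTableau T := by
  unfold IsTableau
  rw [List.isChain_cons]
  simp only [List.mem_cons, forall_eq_or_imp]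
  tauto

theorem head?_tableauInsert (x : α) (T : List (List α)) :
    (tableauInsert x T).head? = some (rowInsert x (T.headD [])).1 := by
  cases T with
  | nil => simp [tableauInsert, rowInsert]
  | cons r rs =>
    rcases h : (rowInsert x r).2 with _ | y
    · rw [tableauInsert_cons_none _ h]; simp
    · rw [tableauInsert_cons_some _ h]; simp

theorem IsTableau.tableauInsert {T : List (List α)} (h : IsTableau T) (x : α) :
    IsTableau (tableauInsert x T) := by
  induction T generalizing x with
  | nil => simp [YoungPerm.tableauInsert, IsTableau]
  | cons r rs ih =>
    rw [isTableau_cons] at h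
    rcases hy : (rowInsert x r).2 with _ | y
    · rw [tableauInsert_cons_none _ hy, isTableau_cons]
      exact ⟨rowInsert_pairwise h.1, fun s hs => (h.2.1 s hs).rowInsert_left x, h.2.2⟩
    · rw [tableauInsert_cons_some _ hy, isTableau_cons]
      refine ⟨rowInsert_pairwise h.1, fun s hs => ?_, ih h.2.2 y⟩
      rw [head?_tableauInsert] at hs
      simp only [Option.mem_def, Option.some.injEq] at hs
      subst hs
      have hb : Below r (rs.headD []) := by
        cases rs with
        | nil => simp [Below]
        | cons s rs => exact h.2.1 s (by simp)
      exact hb.rowInsert_bumped h.1 hy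

theorem insertionTableau_concat (w : List α) (x : α) :
    insertionTableau (w ++ [x]) = tableauInsert x (insertionTableau w) := by
  simp [insertionTableau]

theorem isTableau_insertionTableau (w : List α) : IsTableau (insertionTableau w) := by
  induction w using List.reverseRecOn with
  | nil => simp [insertionTableau, IsTableau]
  | append_singleton w x ih =>
    rw [insertionTableau_concat]
    exact ih.tableauInsert x

theorem flatten_tableauInsert_perm (T : List (List α)) (x : α) :
    (tableauInsert x T).flatten.Perm (x :: T.flatten) := by
  induction T generalizing x with
  | nil => simp [tableauInsert]
  | cons r rs ih =>
    have hp := perm_rowInsert x r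
    rcases hy : (rowInsert x r).2 with _ | y
    · rw [tableauInsert_cons_none _ hy]
      rw [hy] at hp
      simpa using hp.append_right rs.flatten
    · rw [tableauInsert_cons_some _ hy]
      rw [hy] at hp
      simp only [List.flatten_cons]
      refine ((ih y).append_left _).trans ?_
      refine List.perm_middle.trans ?_
      simpa using hp.append_right rs.flatten

theorem flatten_insertionTableau_perm (w : List α) : (insertionTableau w).flatten.Perm w := by
  induction w using List.reverseRecOn with
  | nil => simp [insertionTableau]
  | append_singleton w x ih =>
    rw [insertionTableau_concat]
    refine (flatten_tableauInsert_perm _ x).trans ((ih.cons x).trans ?_)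
    simpa using (List.perm_append_comm (l₁ := [x]) (l₂ := w))

/-! ### The recording tableau and injectivity of the correspondence -/

/-- The index of the row that grows when `x` is inserted into `T`. -/
def insertRow (x : α) : List (List α) → ℕ
  | [] => 0
  | r :: rs =>
    match (rowInsert x r).2 with
    | none => 0
    | some y => insertRow y rs + 1

theorem insertRow_cons_none {x : α} {r : List α} (rs : List (List α))
    (h : (rowInsert x r).2 = none) : insertRow x (r :: rs) = 0 := by
  rw [insertRow, h]

theorem insertRow_cons_some {x y : α} {r : List α} (rs : List (List α))
    (h : (rowInsert x r).2 = some y) : insertRow x (r :: rs) = insertRow y rs + 1 := by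
  rw [insertRow, h]

theorem length_getD_tableauInsert (T : List (List α)) (x : α) (i : ℕ) :
    ((tableauInsert x T).getD i []).length =
      (T.getD i []).length + if i = insertRow x T then 1 else 0 := by
  induction T generalizing x i with
  | nil =>
    cases i with
    | zero => simp [tableauInsert, insertRow]
    | succ i => simp [tableauInsert, insertRow]
  | cons r rs ih =>
    have hl := rowInsert_length x r
    rcases hy : (rowInsert x r).2 with _ | y
    · rw [tableauInsert_cons_none _ hy, insertRow_cons_none _ hy]
      rw [hy] at hl
      cases i with
      | zero => simpa using hl
      | succ i => simp
    · rw [tableauInsert_cons_some _ hy, insertRow_cons_some _ hy]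
      rw [hy] at hl
      cases i with
      | zero => simpa using hl
      | succ i => simpa using ih y i

/-- Bumping can be undone: sortedness forces the box where the bumped letter stood. -/
theorem rowInsert_injective {x x' : α} {r r' : List α} (hr : r.Pairwise (· ≤ ·))
    (hr' : r'.Pairwise (· ≤ ·)) (h : rowInsert x r = rowInsert x' r') : x = x' ∧ r = r' := by
  induction r generalizing r' with
  | nil =>
    cases r' with
    | nil => simpa [rowInsert] using h
    | cons a r' =>
      unfold rowInsert at h
      split_ifs at h with hx
      · simp at h
      · have := rowInsert_length x' r'
        rw [Prod.mk.injEq] at h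
        rw [← h.2] at this
        have h1 := h.1
        simp only [List.cons.injEq] at h1
        rw [← h1.2] at this
        simp at this
  | cons a r ih =>
    cases r' with
    | nil =>
      rw [rowInsert.eq_def x, rowInsert.eq_def x'] at h
      dsimp only at h
      split_ifs at h with hx
      · simp at h
      · have := rowInsert_length x r
        rw [Prod.mk.injEq] at h
        rw [h.2] at this
        have h1 := h.1
        simp only [List.cons.injEq] at h1
        rw [h1.2] at this
        simp at this
    | cons a' r' =>
      rw [List.pairwise_cons] at hr hr'
      rw [rowInsert.eq_def x, rowInsert.eq_def x'] at h
      dsimp only at h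
      split_ifs at h with hx hx' hx'
      · simp only [Prod.mk.injEq, List.cons.injEq, Option.some.injEq] at h
        exact ⟨h.1.1, by rw [h.1.2, h.2]⟩
      -- The two insertions act at different places. Then `a` is the bumped letter on both sides, so
      -- `x' < a`, yet `x'` lies in `r`, whose entries are all at least `a`.
      · simp only [Prod.mk.injEq, List.cons.injEq] at h
        have h1 := lt_of_rowInsert_eq_some h.2.symm
        have h2 := mem_rowInsert_self x' r'
        rw [← h.1.2] at h2
        exact absurd (hr.1 _ h2) (not_le.2 h1.1)
      · simp only [Prod.mk.injEq, List.cons.injEq] at h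
        have h1 := lt_of_rowInsert_eq_some h.2
        have h2 := mem_rowInsert_self x r
        rw [h.1.2] at h2
        exact absurd (hr'.1 _ h2) (not_le.2 h1.1)
      · simp only [Prod.mk.injEq, List.cons.injEq] at h
        obtain ⟨e1, e2⟩ := ih hr.2 hr'.2 (Prod.ext h.1.2 h.2)
        exact ⟨e1, by rw [h.1.1, e2]⟩

theorem rowInsert_ne_singleton {x a : α} {r : List α} (hr : r ≠ [])
    (h : (rowInsert x r).2 = none) : (rowInsert x r).1 ≠ [a] := by
  intro h1
  have := rowInsert_length x r
  rw [h1, h] at this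
  simp at this
  exact hr this

theorem nil_notMem_tableauInsert {T : List (List α)} (h : [] ∉ T) (x : α) :
    [] ∉ tableauInsert x T := by
  have hne : ∀ (x : α) (r : List α), [] ≠ (rowInsert x r).1 := fun x r e => by
    have := mem_rowInsert_self x r
    rw [← e] at this
    simp at this
  induction T generalizing x with
  | nil => simp [tableauInsert]
  | cons r rs ih =>
    simp only [List.mem_cons, not_or] at h
    rcases hy : (rowInsert x r).2 with _ | y
    · rw [tableauInsert_cons_none _ hy]
      simp only [List.mem_cons, not_or]
      exact ⟨hne x r, h.2⟩
    · rw [tableauInsert_cons_some _ hy]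
      simp only [List.mem_cons, not_or]
      exact ⟨hne x r, ih h.2 y⟩

theorem nil_notMem_insertionTableau (w : List α) : [] ∉ insertionTableau w := by
  induction w using List.reverseRecOn with
  | nil => simp [insertionTableau]
  | append_singleton w x ih =>
    rw [insertionTableau_concat]
    exact nil_notMem_tableauInsert ih x

/-- Reverse bumping, started in the row that grew and carried upwards. Empty rows are excluded
because inserting into `[]` and into `[[]]` gives the same result. -/
theorem tableauInsert_injective {T T' : List (List α)} {x x' : α} (hT : IsTableau T)
    (hT' : IsTableau T') (hne : [] ∉ T) (hne' : [] ∉ T')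
    (h : tableauInsert x T = tableauInsert x' T') (hrow : insertRow x T = insertRow x' T') :
    x = x' ∧ T = T' := by
  induction T generalizing T' x x' with
  | nil =>
    cases T' with
    | nil => simpa [tableauInsert] using h
    | cons r' rs' =>
      exfalso
      rcases hy : (rowInsert x' r').2 with _ | y
      · rw [tableauInsert_cons_none _ hy] at h
        simp only [tableauInsert, List.cons.injEq] at h
        exact rowInsert_ne_singleton (fun e => hne' (by simp [e])) hy h.1.symm
      · rw [insertRow_cons_some _ hy] at hrow
        simp [insertRow] at hrow
  | cons r rs ih =>
    cases T' with
    | nil =>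
      exfalso
      rcases hy : (rowInsert x r).2 with _ | y
      · rw [tableauInsert_cons_none _ hy] at h
        simp only [tableauInsert, List.cons.injEq] at h
        exact rowInsert_ne_singleton (fun e => hne (by simp [e])) hy h.1
      · rw [insertRow_cons_some _ hy] at hrow
        simp [insertRow] at hrow
    | cons r' rs' =>
      rw [isTableau_cons] at hT hT'
      simp only [List.mem_cons, not_or] at hne hne'
      rcases hy : (rowInsert x r).2 with _ | y <;> rcases hy' : (rowInsert x' r').2 with _ | y'
      · rw [tableauInsert_cons_none _ hy, tableauInsert_cons_none _ hy'] at h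
        simp only [List.cons.injEq] at h
        obtain ⟨e1, e2⟩ := rowInsert_injective hT.1 hT'.1 (Prod.ext h.1 (hy.trans hy'.symm))
        exact ⟨e1, by rw [e2, h.2]⟩
      · rw [insertRow_cons_none _ hy, insertRow_cons_some _ hy'] at hrow
        simp at hrow
      · rw [insertRow_cons_some _ hy, insertRow_cons_none _ hy'] at hrow
        simp at hrow
      · rw [insertRow_cons_some _ hy, insertRow_cons_some _ hy'] at hrow
        rw [tableauInsert_cons_some _ hy, tableauInsert_cons_some _ hy'] at h
        simp only [List.cons.injEq] at h
        obtain ⟨e1, e2⟩ := ih hT.2.2 hT'.2.2 hne.2 hne'.2 h.2 (by simpa using hrow)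
        obtain ⟨e3, e4⟩ := rowInsert_injective hT.1 hT'.1
          (Prod.ext h.1 (by rw [hy, hy', e1]))
        exact ⟨e3, by rw [e4, e2]⟩

end Insertion


/-! ### The two standard fillings attached to a permutation -/

section Cells

variable {α : Type*}

theorem exists_cell_of_mem_flatten {T : List (List α)} {a : α} (h : a ∈ T.flatten) :
    ∃ r c : ℕ, (T.getD r [])[c]? = some a := by
  obtain ⟨s, hs, ha⟩ := List.mem_flatten.1 h
  obtain ⟨r, hr, rfl⟩ := List.getElem_of_mem hs
  obtain ⟨c, hc, rfl⟩ := List.getElem_of_mem ha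
  refine ⟨r, c, ?_⟩
  rw [List.getD_eq_getElem _ _ hr, List.getElem?_eq_getElem hc]

theorem mem_flatten_of_mem_getD {T : List (List α)} {a : α} {r : ℕ} (h : a ∈ T.getD r []) :
    a ∈ T.flatten := by
  by_cases hr : r < T.length
  · rw [List.getD_eq_getElem _ _ hr] at h
    exact List.mem_flatten.2 ⟨_, List.getElem_mem hr, h⟩
  · rw [List.getD_eq_default _ _ (not_lt.1 hr)] at h
    simp at h

theorem cell_unique {T : List (List α)} (hT : T.flatten.Nodup) {a : α} {r c r' c' : ℕ}
    (h : (T.getD r [])[c]? = some a) (h' : (T.getD r' [])[c']? = some a) : r = r' ∧ c = c' := by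
  induction T generalizing r r' with
  | nil => simp at h
  | cons s T ih =>
    rw [List.flatten_cons, List.nodup_append'] at hT
    cases r with
    | zero =>
      cases r' with
      | zero =>
        simp only [List.getD_cons_zero] at h h'
        refine ⟨rfl, ?_⟩
        exact (List.getElem?_inj (List.getElem?_eq_some_iff.1 h).1 hT.1).1 (h.trans h'.symm)
      | succ r' =>
        simp only [List.getD_cons_zero, List.getD_cons_succ] at h h'
        exact (hT.2.2 (List.mem_of_getElem? h)
          (mem_flatten_of_mem_getD (List.mem_of_getElem? h'))).elim
    | succ r =>
      cases r' with
      | zero =>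
        simp only [List.getD_cons_zero, List.getD_cons_succ] at h h'
        exact (hT.2.2 (List.mem_of_getElem? h')
          (mem_flatten_of_mem_getD (List.mem_of_getElem? h))).elim
      | succ r' =>
        simp only [List.getD_cons_succ] at h h'
        obtain ⟨e1, e2⟩ := ih hT.2.1 h h'
        exact ⟨by rw [e1], e2⟩

theorem nodup_getD {T : List (List α)} (hT : T.flatten.Nodup) (r : ℕ) : (T.getD r []).Nodup := by
  by_cases hr : r < T.length
  · rw [List.getD_eq_getElem _ _ hr]
    exact (List.nodup_flatten.1 hT).1 _ (List.getElem_mem hr)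
  · rw [List.getD_eq_default _ _ (not_lt.1 hr)]
    exact List.nodup_nil

variable [LinearOrder α]

theorem IsTableau.below_getD {T : List (List α)} (hT : IsTableau T) (r : ℕ) :
    Below (T.getD r []) (T.getD (r + 1) []) := by
  by_cases hr : r + 1 < T.length
  · rw [List.getD_eq_getElem _ _ hr, List.getD_eq_getElem _ _ (by omega)]
    exact List.isChain_iff_getElem.1 hT.2 r hr
  · rw [List.getD_eq_default _ _ (not_lt.1 hr)]
    exact below_nil _

theorem IsTableau.pairwise_getD {T : List (List α)} (hT : IsTableau T) (r : ℕ) :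
    (T.getD r []).Pairwise (· ≤ ·) := by
  by_cases hr : r < T.length
  · rw [List.getD_eq_getElem _ _ hr]
    exact hT.1 _ (List.getElem_mem hr)
  · rw [List.getD_eq_default _ _ (not_lt.1 hr)]
    exact List.Pairwise.nil

/-- Rows are sorted, so the row of each letter determines the tableau. This is why row functions
alone can separate permutations later. -/
theorem IsTableau.eq_of_mem_iff {T T' : List (List α)} (hT : IsTableau T) (hT' : IsTableau T')
    (hn : T.flatten.Nodup) (hn' : T'.flatten.Nodup) (hne : [] ∉ T) (hne' : [] ∉ T')
    (h : ∀ r a, a ∈ T.getD r [] ↔ a ∈ T'.getD r []) : T = T' := by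
  have hrow : ∀ r, T.getD r [] = T'.getD r [] := fun r =>
    List.Perm.eq_of_pairwise (le := (· ≤ ·)) (fun a b _ _ h1 h2 => le_antisymm h1 h2)
      (hT.pairwise_getD r) (hT'.pairwise_getD r)
      ((List.perm_ext_iff_of_nodup (nodup_getD hn r) (nodup_getD hn' r)).2 (h r))
  have hlen : ∀ {T : List (List α)}, [] ∉ T → ∀ r, r < T.length ↔ T.getD r [] ≠ [] := by
    intro T hT r
    by_cases hr : r < T.length
    · rw [List.getD_eq_getElem _ _ hr]
      exact ⟨fun _ e => hT (e ▸ List.getElem_mem hr), fun _ => hr⟩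
    · simp [hr]
  have hl : T.length = T'.length := by
    have key : ∀ r, r < T.length ↔ r < T'.length := fun r => by rw [hlen hne, hlen hne', hrow]
    have h1 := key T.length
    have h2 := key T'.length
    omega
  refine List.ext_getElem hl fun r h1 h2 => ?_
  rw [← List.getD_eq_getElem _ [] h1, ← List.getD_eq_getElem _ [] h2, hrow]

theorem eq_of_insertionTableau_eq {w w' : List α} (hl : w.length = w'.length)
    (hT : insertionTableau w = insertionTableau w')
    (hrow : ∀ (i : ℕ) (h : i < w.length) (h' : i < w'.length),
      insertRow w[i] (insertionTableau (w.take i)) =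
        insertRow w'[i] (insertionTableau (w'.take i))) : w = w' := by
  induction w using List.reverseRecOn generalizing w' with
  | nil => exact (List.length_eq_zero_iff.1 hl.symm).symm
  | append_singleton w x ih =>
    rcases List.eq_nil_or_concat w' with rfl | ⟨w', x', rfl⟩
    · simp at hl
    rw [List.concat_eq_append] at *
    have hl' : w.length = w'.length := by simpa using hl
    rw [insertionTableau_concat, insertionTableau_concat] at hT
    have h0 := hrow w.length (by simp) (by simp [hl'])
    have e1 : (w ++ [x])[w.length]'(by simp) = x := by simp
    have e2 : (w' ++ [x'])[w.length]'(by simp [hl']) = x' := by simp [hl']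
    have e3 : (w ++ [x]).take w.length = w := by simp
    have e4 : (w' ++ [x']).take w.length = w' := by simp [hl']
    rw [e1, e2, e3, e4] at h0
    obtain ⟨e5, e6⟩ := tableauInsert_injective (isTableau_insertionTableau w)
      (isTableau_insertionTableau w') (nil_notMem_insertionTableau w)
      (nil_notMem_insertionTableau w') hT h0
    have e7 : w = w' := ih hl' e6 fun i h h' => by
      have := hrow i (by simp; omega) (by simp; omega)
      rwa [List.getElem_append_left h, List.getElem_append_left h',
        List.take_append_of_le_length h.le, List.take_append_of_le_length h'.le] at this
    rw [e5, e7]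

end Cells

/-- `rc i` is the box (row, column) that holds `i`: no box is used twice, and the box above the
box of `i` holds a smaller number. -/
def IsStandardFilling {n : ℕ} (rc : Fin n → ℕ × ℕ) : Prop :=
  Function.Injective rc ∧ ∀ i r c, rc i = (r + 1, c) → ∃ j < i, rc j = (r, c)

theorem card_row_eq {n : ℕ} {rc : Fin n → ℕ × ℕ} (hrc : Function.Injective rc) {len : ℕ → ℕ}
    (h : ∀ r c, c < len r ↔ ∃ i, rc i = (r, c)) (r : ℕ) :
    (Finset.univ.filter fun i => (rc i).1 = r).card = len r := by
  rw [← Finset.card_range (len r)]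
  refine Finset.card_bij (fun i _ => (rc i).2) ?_ ?_ ?_
  · intro i hi
    rw [Finset.mem_filter] at hi
    exact Finset.mem_range.2 ((h r _).2 ⟨i, Prod.ext hi.2 rfl⟩)
  · intro i hi j hj hij
    rw [Finset.mem_filter] at hi hj
    exact hrc (Prod.ext (hi.2.trans hj.2.symm) hij)
  · intro c hc
    obtain ⟨i, hi⟩ := (h r c).1 (Finset.mem_range.1 hc)
    exact ⟨i, by simp [hi], by simp [hi]⟩

/-- The word `σ(1) σ(2) … σ(n)`. -/
def permWord {n : ℕ} (σ : Equiv.Perm (Fin n)) : List (Fin n) := List.ofFn fun i => σ i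

theorem nodup_permWord {n : ℕ} (σ : Equiv.Perm (Fin n)) : (permWord σ).Nodup :=
  List.nodup_ofFn.2 σ.injective

theorem mem_permWord {n : ℕ} (σ : Equiv.Perm (Fin n)) (a : Fin n) : a ∈ permWord σ :=
  List.mem_ofFn.2 ⟨σ.symm a, σ.apply_symm_apply a⟩

theorem length_permWord {n : ℕ} (σ : Equiv.Perm (Fin n)) : (permWord σ).length = n :=
  List.length_ofFn

theorem nodup_flatten_permWord {n : ℕ} (σ : Equiv.Perm (Fin n)) :
    (insertionTableau (permWord σ)).flatten.Nodup :=
  (flatten_insertionTableau_perm _).nodup_iff.2 (nodup_permWord σ)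

theorem pairwise_map_length {α : Type*} [LinearOrder α] {T : List (List α)} (hT : IsTableau T) :
    (T.map List.length).Pairwise (· ≥ ·) := by
  rw [List.pairwise_map]
  have : Trans (Below (α := α)) Below Below := ⟨Below.trans⟩
  exact (List.isChain_iff_pairwise.1 hT.2).imp fun h => h.length_le

theorem part_rsShape {n : ℕ} (σ : Equiv.Perm (Fin n)) (r : ℕ) :
    part (rsShape σ) r = ((insertionTableau (permWord σ)).getD r []).length := by
  unfold rsShape
  rw [part_ofSums (pairwise_map_length (isTableau_insertionTableau _))]
  change (List.map List.length (insertionTableau (permWord σ))).getD r ([] : List (Fin n)).length = _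
  rw [List.getD_map]

theorem exists_insertion_filling {n : ℕ} (σ : Equiv.Perm (Fin n)) : ∃ rc : Fin n → ℕ × ℕ,
    ∀ a r c, rc a = (r, c) ↔ ((insertionTableau (permWord σ)).getD r [])[c]? = some a := by
  have h : ∀ a, ∃ rc : ℕ × ℕ,
      ((insertionTableau (permWord σ)).getD rc.1 [])[rc.2]? = some a := fun a => by
    obtain ⟨r, c, h⟩ := exists_cell_of_mem_flatten
      ((flatten_insertionTableau_perm (permWord σ)).mem_iff.2 (mem_permWord σ a))
    exact ⟨(r, c), h⟩
  choose rc hrc using h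
  refine ⟨rc, fun a r c => ⟨fun h => ?_, fun h => ?_⟩⟩
  · have := hrc a
    rwa [h] at this
  · obtain ⟨e1, e2⟩ := cell_unique (nodup_flatten_permWord σ) (hrc a) h
    exact Prod.ext e1 e2

/-- The box of `a` in the insertion tableau of `σ`. -/
noncomputable def insertionFilling {n : ℕ} (σ : Equiv.Perm (Fin n)) : Fin n → ℕ × ℕ :=
  (exists_insertion_filling σ).choose

theorem insertionFilling_eq_iff {n : ℕ} (σ : Equiv.Perm (Fin n)) (a : Fin n) (r c : ℕ) :
    insertionFilling σ a = (r, c) ↔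
      ((insertionTableau (permWord σ)).getD r [])[c]? = some a :=
  (exists_insertion_filling σ).choose_spec a r c

theorem isStandardFilling_insertionFilling {n : ℕ} (σ : Equiv.Perm (Fin n)) :
    IsStandardFilling (insertionFilling σ) := by
  constructor
  · intro a b hab
    have h1 := (insertionFilling_eq_iff σ a (insertionFilling σ a).1 (insertionFilling σ a).2).1 rfl
    have h2 := (insertionFilling_eq_iff σ b (insertionFilling σ b).1 (insertionFilling σ b).2).1 rfl
    rw [← hab, h1] at h2
    exact Option.some.inj h2
  · intro a r c h
    rw [insertionFilling_eq_iff] at h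
    obtain ⟨b, hb, hlt⟩ := ((isTableau_insertionTableau (permWord σ)).below_getD r).getElem? h
    exact ⟨b, hlt, (insertionFilling_eq_iff σ b r c).2 hb⟩

theorem lt_part_iff_insertionFilling {n : ℕ} (σ : Equiv.Perm (Fin n)) (r c : ℕ) :
    c < part (rsShape σ) r ↔ ∃ a, insertionFilling σ a = (r, c) := by
  rw [part_rsShape]
  simp only [insertionFilling_eq_iff]
  constructor
  · intro h
    exact ⟨_, List.getElem?_eq_getElem h⟩
  · rintro ⟨a, ha⟩
    exact (List.getElem?_eq_some_iff.1 ha).1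

/-- The tableau obtained from the first `m` letters of the word of `σ`. -/
def prefixTableau {n : ℕ} (σ : Equiv.Perm (Fin n)) (m : ℕ) : List (List (Fin n)) :=
  insertionTableau ((permWord σ).take m)

/-- The box of `i` in the recording tableau of `σ`: the box added by the `i`-th insertion. -/
def recordingFilling {n : ℕ} (σ : Equiv.Perm (Fin n)) (i : Fin n) : ℕ × ℕ :=
  (insertRow (σ i) (prefixTableau σ i),
    ((prefixTableau σ i).getD (insertRow (σ i) (prefixTableau σ i)) []).length)

theorem prefixTableau_succ {n : ℕ} (σ : Equiv.Perm (Fin n)) (i : Fin n) :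
    prefixTableau σ (i + 1) = tableauInsert (σ i) (prefixTableau σ i) := by
  unfold prefixTableau
  rw [← insertionTableau_concat]
  have h : (i : ℕ) < (permWord σ).length := by rw [length_permWord]; exact i.2
  rw [← List.take_concat_get' _ _ h]
  simp [permWord]

/-- The boxes recorded for the first `m` letters make up the diagram of the `m`-th prefix tableau.
Standardness of the recording filling follows, as each of these diagrams is closed under moving up a
column. -/
theorem lt_prefixTableau_iff {n : ℕ} (σ : Equiv.Perm (Fin n)) {m : ℕ} (hm : m ≤ n) (r c : ℕ) :
    c < ((prefixTableau σ m).getD r []).length ↔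
      ∃ i : Fin n, (i : ℕ) < m ∧ recordingFilling σ i = (r, c) := by
  induction m with
  | zero => simp [prefixTableau, insertionTableau]
  | succ m ih =>
    have hstep := prefixTableau_succ σ ⟨m, hm⟩
    simp only at hstep
    rw [hstep, length_getD_tableauInsert]
    have hlast : ∀ r c, recordingFilling σ ⟨m, hm⟩ = (r, c) ↔
        r = insertRow (σ ⟨m, hm⟩) (prefixTableau σ m) ∧
          c = ((prefixTableau σ m).getD r []).length := by
      intro r c
      unfold recordingFilling
      rw [Prod.mk.injEq]
      constructor
      · rintro ⟨rfl, rfl⟩; exact ⟨rfl, rfl⟩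
      · rintro ⟨rfl, rfl⟩; exact ⟨rfl, rfl⟩
    have hsplit : (∃ i : Fin n, (i : ℕ) < m + 1 ∧ recordingFilling σ i = (r, c)) ↔
        (∃ i : Fin n, (i : ℕ) < m ∧ recordingFilling σ i = (r, c)) ∨
          recordingFilling σ ⟨m, hm⟩ = (r, c) := by
      constructor
      · rintro ⟨i, hi, h⟩
        rcases Nat.lt_succ_iff_lt_or_eq.1 hi with hi | hi
        · exact Or.inl ⟨i, hi, h⟩
        · right
          rw [← h]
          congr 1
          exact Fin.ext hi.symm
      · rintro (⟨i, hi, h⟩ | h)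
        · exact ⟨i, by omega, h⟩
        · exact ⟨_, by simp, h⟩
    rw [hsplit, ← ih (by omega), hlast]
    split_ifs with hr <;> omega

theorem isStandardFilling_recordingFilling {n : ℕ} (σ : Equiv.Perm (Fin n)) :
    IsStandardFilling (recordingFilling σ) := by
  have hlt : ∀ i j : Fin n, i < j → recordingFilling σ i ≠ recordingFilling σ j := by
    intro i j hij h
    -- The box of `j` lies just past the end of a row of the prefix tableau, while the box of `i` is
    -- already inside.
    have h1 := (lt_prefixTableau_iff σ j.2.le _ _).2 ⟨i, hij, h⟩
    exact lt_irrefl _ h1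
  constructor
  · intro i j h
    rcases lt_trichotomy i j with hij | hij | hij
    · exact absurd h (hlt i j hij)
    · exact hij
    · exact absurd h.symm (hlt j i hij)
  · intro i r c h
    have h1 := (lt_prefixTableau_iff σ (m := i + 1) i.2 (r + 1) c).2 ⟨i, by simp, h⟩
    have h2 := ((isTableau_insertionTableau ((permWord σ).take (i + 1))).below_getD r).length_le
    have h3 := (lt_prefixTableau_iff σ (m := i + 1) i.2 r c).1 (lt_of_lt_of_le h1 h2)
    obtain ⟨j, hj, hjr⟩ := h3
    refine ⟨j, ?_, hjr⟩
    rcases Nat.lt_succ_iff_lt_or_eq.1 hj with hj | hj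
    · exact hj
    · rw [Fin.ext hj, h] at hjr
      simp at hjr

theorem lt_part_iff_recordingFilling {n : ℕ} (σ : Equiv.Perm (Fin n)) (r c : ℕ) :
    c < part (rsShape σ) r ↔ ∃ i, recordingFilling σ i = (r, c) := by
  have h := lt_prefixTableau_iff σ le_rfl r c
  have e : prefixTableau σ n = insertionTableau (permWord σ) := by
    unfold prefixTableau
    rw [List.take_of_length_le (length_permWord σ).le]
  rw [e, ← part_rsShape] at h
  simpa using h

/-- A permutation is determined by the rows of its insertion and recording tableaux. -/
theorem eq_of_fillings_eq {n : ℕ} {σ τ : Equiv.Perm (Fin n)}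
    (hP : ∀ a, (insertionFilling σ a).1 = (insertionFilling τ a).1)
    (hQ : ∀ i, (recordingFilling σ i).1 = (recordingFilling τ i).1) : σ = τ := by
  have hmem : ∀ (σ : Equiv.Perm (Fin n)) r a,
      a ∈ (insertionTableau (permWord σ)).getD r [] ↔ (insertionFilling σ a).1 = r := by
    intro σ r a
    rw [List.mem_iff_getElem?]
    simp only [← insertionFilling_eq_iff]
    constructor
    · rintro ⟨c, hc⟩; rw [hc]
    · rintro rfl; exact ⟨_, rfl⟩
  have hT : insertionTableau (permWord σ) = insertionTableau (permWord τ) :=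
    (isTableau_insertionTableau _).eq_of_mem_iff (isTableau_insertionTableau _)
      (nodup_flatten_permWord σ) (nodup_flatten_permWord τ) (nil_notMem_insertionTableau _)
      (nil_notMem_insertionTableau _) fun r a => by rw [hmem, hmem, hP]
  have hw : permWord σ = permWord τ := by
    refine eq_of_insertionTableau_eq (by rw [length_permWord, length_permWord]) hT fun i h h' => ?_
    have hi : i < n := by rwa [length_permWord] at h
    have := hQ ⟨i, hi⟩
    simpa [recordingFilling, prefixTableau, permWord] using this
  exact Equiv.ext fun i => congrFun (List.ofFn_injective hw) i


/-! ### Disjoint decreasing subsequences -/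

section Greene

variable {α : Type*}

/-- The row reading word of a tableau: rows from bottom to top. -/
def readingWord : List (List α) → List α
  | [] => []
  | r :: rs => readingWord rs ++ r

theorem readingWord_perm (T : List (List α)) : (readingWord T).Perm T.flatten := by
  induction T with
  | nil => exact List.Perm.refl _
  | cons r rs ih => exact List.perm_append_comm.trans (ih.append_left r)

theorem countP_of_column {r : List α} {c : α → ℕ} {m : ℕ}
    (hc : ∀ (j : ℕ) a, r[j]? = some a → c a = j + m) (k : ℕ) :
    r.countP (fun a => c a < k) = min (k - m) r.length := by
  induction r generalizing m with
  | nil => simp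
  | cons a r ih =>
    have h0 := hc 0 a (by simp)
    rw [List.countP_cons, ih (m := m + 1) fun j b hb => by
      rw [hc (j + 1) b (by simpa using hb)]; omega]
    simp only [h0, List.length_cons]
    by_cases h : m < k
    · simp [h]; omega
    · simp [h]; omega

theorem countP_readingWord {T : List (List α)} {c : α → ℕ}
    (hc : ∀ r ∈ T, ∀ (j : ℕ) a, r[j]? = some a → c a = j) (k : ℕ) :
    (readingWord T).countP (fun a => c a < k) = ((T.map List.length).map (min k)).sum := by
  induction T with
  | nil => simp [readingWord]
  | cons r rs ih =>
    rw [readingWord, List.countP_append, ih fun s hs => hc s (List.mem_cons_of_mem _ hs),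
      countP_of_column (m := 0) (hc r (by simp))]
    simp [add_comm]

variable [LinearOrder α]

/-- The letters of `w` of each colour `< k` form a decreasing subsequence. -/
def IsDecreasingColouring (k : ℕ) (c : α → ℕ) (w : List α) : Prop :=
  w.Pairwise fun a b => c a = c b → c a < k → b < a

/-- Elementary transformations along which, read from right to left, families of disjoint
decreasing subsequences can be transported. -/
inductive ColourStep : List α → List α → Prop
  | swap (l₁ l₂ : List α) {x z : α} (h : x < z) :
      ColourStep (l₁ ++ z :: x :: l₂) (l₁ ++ x :: z :: l₂)
  | knuth (l₁ l₂ : List α) {x y z : α} (h : x < y) (h' : y < z) :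
      ColourStep (l₁ ++ x :: z :: y :: l₂) (l₁ ++ z :: x :: y :: l₂)

theorem ColourStep.perm {w w' : List α} (h : ColourStep w w') : w.Perm w' := by
  cases h with
  | swap l₁ l₂ h => exact (List.Perm.swap _ _ _).append_left _
  | knuth l₁ l₂ h h' => exact (List.Perm.swap _ _ _).append_left _

theorem ColourStep.append {w w' : List α} (h : ColourStep w w') (u v : List α) :
    ColourStep (u ++ w ++ v) (u ++ w' ++ v) := by
  cases h with
  | swap l₁ l₂ h => simpa using ColourStep.swap (u ++ l₁) (l₂ ++ v) h
  | knuth l₁ l₂ h h' => simpa using ColourStep.knuth (u ++ l₁) (l₂ ++ v) h h'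

/-- The subsequence running through `z, x` breaks when `x` moves in front of `z`. It is repaired by
exchanging tails: `z` continues with `y` and what followed `y`, while `x` takes the place of `y` and
keeps what followed `x`. -/
theorem IsDecreasingColouring.exists_knuth {k : ℕ} {c : α → ℕ} {l₁ l₂ : List α} {x y z : α}
    (hxy : x < y) (hyz : y < z) (hnd : (l₁ ++ z :: x :: y :: l₂).Nodup)
    (hc : IsDecreasingColouring k c (l₁ ++ z :: x :: y :: l₂)) (hzx : c z = c x) (hk : c x < k) :
    ∃ c', IsDecreasingColouring k c' (l₁ ++ x :: z :: y :: l₂) ∧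
      (l₁ ++ x :: z :: y :: l₂).countP (fun a => c' a < k) =
        (l₁ ++ z :: x :: y :: l₂).countP (fun a => c a < k) := by
  classical
  unfold IsDecreasingColouring at hc
  simp only [List.pairwise_append, List.pairwise_cons, List.mem_cons, forall_eq_or_imp] at hc
  obtain ⟨h11, ⟨⟨hz_x, hz_y, hz2⟩, ⟨hx_y, hx2⟩, hy2, h22⟩, h1⟩ := hc
  have hne : c y ≠ c x := fun e => absurd (hx_y e.symm hk) (not_lt.2 hxy.le)
  simp only [List.nodup_append', List.nodup_cons, List.mem_cons, not_or, List.disjoint_cons_right]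
    at hnd
  obtain ⟨-, ⟨⟨-, -, hz2'⟩, ⟨-, hx2'⟩, hy2', -⟩, hz1, hx1, hy1, hd⟩ := hnd
  -- `g` recolours `l₂`. If `y` belongs to no subsequence there is no tail to exchange: `y` merely
  -- replaces `x`, which drops out.
  let g : ℕ → ℕ := fun m => if c y < k then Equiv.swap (c x) (c y) m else m
  have hginj : Function.Injective g := by
    intro a b hab
    simp only [g] at hab
    split_ifs at hab
    · exact (Equiv.swap _ _).injective hab
    · exact hab
  have hgk : ∀ m, g m < k ↔ m < k := by
    intro m
    simp only [g]
    split_ifs with h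
    · rw [Equiv.swap_apply_def]
      split_ifs <;> omega
    · rfl
  let c' : α → ℕ := fun a => if a = x then c y else if a = y then c x else
    if a ∈ l₂ then g (c a) else c a
  have cx : c' x = c y := by simp [c']
  have cy : c' y = c x := by simp [c', hxy.ne']
  have cz : c' z = c x := by simp [c', (hxy.trans hyz).ne', hyz.ne', hz2', hzx]
  have c1 : ∀ a ∈ l₁, c' a = c a := by
    intro a ha
    have e1 : a ≠ x := fun e => hx1 (e ▸ ha)
    have e2 : a ≠ y := fun e => hy1 (e ▸ ha)
    have e3 : a ∉ l₂ := fun e => hd ha e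
    simp [c', e1, e2, e3]
  have c2 : ∀ a ∈ l₂, c' a = g (c a) := by
    intro a ha
    have e1 : a ≠ x := fun e => hx2' (e ▸ ha)
    have e2 : a ≠ y := fun e => hy2' (e ▸ ha)
    simp [c', e1, e2, ha]
  have gx : ∀ m, g m = c x → (c y < k ∧ m = c y) ∨ (¬ c y < k ∧ m = c x) := by
    intro m hm
    simp only [g] at hm
    split_ifs at hm with h
    · left
      refine ⟨h, ?_⟩
      rw [Equiv.swap_apply_def] at hm
      split_ifs at hm <;> omega
    · exact Or.inr ⟨h, hm⟩
  have gy : ∀ m, g m = c y → c y < k → m = c x := by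
    intro m hm h
    simp only [g, if_pos h] at hm
    rw [Equiv.swap_apply_def] at hm
    split_ifs at hm <;> omega
  refine ⟨c', ?_, ?_⟩
  · unfold IsDecreasingColouring
    simp only [List.pairwise_append, List.pairwise_cons, List.mem_cons, forall_eq_or_imp]
    refine ⟨?_, ⟨⟨?_, ?_, ?_⟩, ⟨?_, ?_⟩, ?_, ?_⟩, ?_⟩
    · refine h11.imp_of_mem fun {a b} ha hb h => ?_
      rw [c1 a ha, c1 b hb]
      exact h
    · rw [cx, cz]
      exact fun e => absurd e hne
    · rw [cx, cy]
      exact fun e => absurd e hne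
    · intro b hb
      rw [cx, c2 b hb]
      intro e hlt
      exact hx2 b hb (gy _ e.symm hlt).symm hk
    · exact fun _ _ => hyz
    · intro b hb
      rw [cz, c2 b hb]
      intro e _
      rcases gx _ e.symm with ⟨h, h'⟩ | ⟨h, h'⟩
      · exact (hy2 b hb h'.symm h).trans hyz
      · exact hz2 b hb (hzx.trans h'.symm) (hzx ▸ hk)
    · intro b hb
      rw [cy, c2 b hb]
      intro e _
      rcases gx _ e.symm with ⟨h, h'⟩ | ⟨h, h'⟩
      · exact hy2 b hb h'.symm h
      · exact (hx2 b hb h'.symm hk).trans hxy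
    · refine h22.imp_of_mem fun {a b} ha hb h => ?_
      rw [c2 a ha, c2 b hb, hgk]
      exact fun e => h (hginj e)
    · intro a ha
      obtain ⟨haz, hax, hay, ha2⟩ := h1 a ha
      rw [c1 a ha, cx, cz, cy]
      refine ⟨fun e hlt => hxy.trans (hay e hlt), fun e hlt => haz (e.trans hzx.symm) hlt,
        fun e hlt => hyz.trans (haz (e.trans hzx.symm) hlt), fun b hb => ?_⟩
      rw [c2 b hb]
      intro e hlt
      simp only [g] at e
      split_ifs at e with h
      · rw [Equiv.swap_apply_def] at e
        split_ifs at e with e1 e2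
        · exact ((hx2 b hb e1.symm hk).trans hxy).trans (hay e hlt)
        · exact ((hy2 b hb e2.symm h).trans hyz).trans (haz (e.trans hzx.symm) hlt)
        · exact ha2 b hb e hlt
      · exact ha2 b hb e hlt
  · have e1 : l₁.countP (fun a => c' a < k) = l₁.countP (fun a => c a < k) :=
      List.countP_congr fun a ha => by rw [c1 a ha]
    have e2 : l₂.countP (fun a => c' a < k) = l₂.countP (fun a => c a < k) :=
      List.countP_congr fun a ha => by simp only [c2 a ha, hgk]
    simp only [List.countP_append, List.countP_cons, e1, e2, cx, cy, cz, hzx]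
    omega

theorem ColourStep.exists_colouring {k : ℕ} {w w' : List α} (h : ColourStep w w')
    (hnd : w'.Nodup) {c : α → ℕ} (hc : IsDecreasingColouring k c w') :
    ∃ c', IsDecreasingColouring k c' w ∧
      w.countP (fun a => c' a < k) = w'.countP (fun a => c a < k) := by
  have hp := h.perm
  cases h with
  | swap l₁ l₂ h =>
    refine ⟨c, ?_, hp.countP_eq _⟩
    unfold IsDecreasingColouring at hc ⊢
    simp only [List.pairwise_append, List.pairwise_cons, List.mem_cons, forall_eq_or_imp] at hc ⊢
    exact ⟨hc.1, ⟨⟨fun _ _ => h, hc.2.1.2.1⟩, hc.2.1.1.2, hc.2.1.2.2⟩,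
      fun a ha => ⟨(hc.2.2 a ha).2.1, (hc.2.2 a ha).1, (hc.2.2 a ha).2.2⟩⟩
  | @knuth l₁ l₂ x y z h h' =>
    -- Unless `z` and `x` share a subsequence, their relative order is irrelevant and the old
    -- colouring survives.
    by_cases hcz : c z = c x ∧ c x < k
    · exact hc.exists_knuth h h' hnd hcz.1 hcz.2
    · refine ⟨c, ?_, hp.countP_eq _⟩
      unfold IsDecreasingColouring at hc ⊢
      simp only [List.pairwise_append, List.pairwise_cons, List.mem_cons, forall_eq_or_imp]
        at hc ⊢
      exact ⟨hc.1, ⟨⟨fun e hlt => absurd ⟨e.symm, hlt⟩ hcz, hc.2.1.2.1⟩, hc.2.1.1.2, hc.2.1.2.2⟩,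
        fun a ha => ⟨(hc.2.2 a ha).2.1, (hc.2.2 a ha).1, (hc.2.2 a ha).2.2⟩⟩

theorem exists_colouring_of_reflTransGen {k : ℕ} {w w' : List α}
    (h : Relation.ReflTransGen ColourStep w w') (hnd : w.Nodup) {c : α → ℕ}
    (hc : IsDecreasingColouring k c w') :
    ∃ c', IsDecreasingColouring k c' w ∧
      w.countP (fun a => c' a < k) = w'.countP (fun a => c a < k) := by
  induction h using Relation.ReflTransGen.head_induction_on with
  | refl => exact ⟨c, hc, rfl⟩
  | head h _ ih =>
    have hnd' := h.perm.nodup_iff.1 hnd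
    obtain ⟨c₁, h1, h2⟩ := ih hnd'
    obtain ⟨c₂, h3, h4⟩ := h.exists_colouring hnd' h1
    exact ⟨c₂, h3, h4.trans h2⟩

theorem reflTransGen_append {w w' : List α} (h : Relation.ReflTransGen ColourStep w w')
    (u v : List α) : Relation.ReflTransGen ColourStep (u ++ w ++ v) (u ++ w' ++ v) :=
  h.lift (fun l => u ++ l ++ v) fun _ _ h => h.append u v

/-- Colourings are only pulled back, and pulling back through `swap` creates a descent, which is
harmless. So this move needs no Knuth condition on neighbouring letters. -/
theorem reflTransGen_move {x : α} {r : List α} (h : ∀ z ∈ r, x < z) :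
    Relation.ReflTransGen ColourStep (r ++ [x]) (x :: r) := by
  induction r with
  | nil => exact Relation.ReflTransGen.refl
  | cons a r ih =>
    have h1 := reflTransGen_append (ih fun z hz => h z (List.mem_cons_of_mem _ hz)) [a] []
    simp only [List.append_nil, List.singleton_append] at h1
    exact h1.tail (ColourStep.swap [] r (h a (by simp)))

/-- The letter `x` travels left past the larger letters until it stands just behind `y`; then `y`
travels left past each smaller `a`. The first entry `b` of the new remaining row satisfies `a < b <
y` and is the witness for the Knuth step. -/
theorem reflTransGen_rowInsert {x y : α} {r : List α} (hr : r.Pairwise (· < ·)) (hx : x ∉ r)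
    (hy : (rowInsert x r).2 = some y) :
    Relation.ReflTransGen ColourStep (r ++ [x]) (y :: (rowInsert x r).1) := by
  induction r with
  | nil => simp [rowInsert] at hy
  | cons a r ih =>
    rw [List.pairwise_cons] at hr
    simp only [List.mem_cons, not_or] at hx
    rw [rowInsert.eq_def x (a :: r)] at hy ⊢
    dsimp only at hy ⊢
    split_ifs at hy ⊢ with hxa
    · simp only [Option.some.injEq] at hy
      subst hy
      have h1 := reflTransGen_append (reflTransGen_move fun z hz => hxa.trans (hr.1 z hz)) [a] []
      simpa using h1
    · have h1 := reflTransGen_append (ih hr.2 hx.2 hy) [a] []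
      simp only [List.append_nil, List.singleton_append] at h1
      have hax : a < x := lt_of_le_of_ne (not_lt.1 hxa) (Ne.symm hx.1)
      obtain ⟨b, l, hbl⟩ : ∃ b l, (rowInsert x r).1 = b :: l :=
        List.exists_cons_of_ne_nil (List.ne_nil_of_mem (mem_rowInsert_self x r))
      have hxy := (lt_of_rowInsert_eq_some hy).1
      have hab : a < b := by
        rcases mem_of_mem_rowInsert (x := x) (r := r) (z := b) (by rw [hbl]; simp) with rfl | hb
        · exact hax
        · exact hr.1 b hb
      have hby : b < y := by
        have hs := rowInsert_pairwise (x := x) (hr.2.imp le_of_lt)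
        have hm := mem_rowInsert_self x r
        rw [hbl] at hs hm
        rw [List.pairwise_cons] at hs
        rcases List.mem_cons.1 hm with rfl | hm
        · exact hxy
        · exact (hs.1 x hm).trans_lt hxy
      rw [hbl] at h1 ⊢
      exact h1.tail (ColourStep.knuth [] l hab hby)

theorem rowInsert_none {x : α} {r : List α} (h : (rowInsert x r).2 = none) :
    (rowInsert x r).1 = r ++ [x] := by
  induction r with
  | nil => simp [rowInsert]
  | cons a r ih =>
    rw [rowInsert.eq_def x (a :: r)] at h ⊢
    dsimp only at h ⊢
    split_ifs at h ⊢ with hx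
    simpa using ih h

/-- Rows are read from the bottom, so the letter bumped to the front of the top row stands right
behind the word of the lower rows, ready to be inserted there. -/
theorem reflTransGen_tableauInsert {T : List (List α)} (hT : ∀ r ∈ T, r.Pairwise (· ≤ ·)) {x : α}
    (hnd : (x :: T.flatten).Nodup) :
    Relation.ReflTransGen ColourStep (readingWord T ++ [x]) (readingWord (tableauInsert x T)) := by
  induction T generalizing x with
  | nil => simpa [tableauInsert, readingWord] using Relation.ReflTransGen.refl
  | cons r rs ih =>
    rcases hy : (rowInsert x r).2 with _ | y
    · rw [tableauInsert_cons_none _ hy, rowInsert_none hy]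
      simpa [readingWord] using Relation.ReflTransGen.refl
    · rw [tableauInsert_cons_some _ hy]
      have hp := perm_rowInsert x r
      rw [hy] at hp
      have hnd' : (y :: rs.flatten).Nodup := by
        have h1 : (y :: ((rowInsert x r).1 ++ rs.flatten)).Nodup := by
          refine ((hp.append_right rs.flatten).nodup_iff).2 ?_
          simpa using hnd
        rw [List.nodup_cons] at h1 ⊢
        exact ⟨fun h => h1.1 (List.mem_append_right _ h), h1.2.of_append_right⟩
      rw [List.flatten_cons, List.nodup_cons, List.mem_append, not_or] at hnd
      have hr : r.Pairwise (· < ·) :=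
        ((hT r (by simp)).and hnd.2.of_append_left).imp fun h => lt_of_le_of_ne h.1 h.2
      have h1 := reflTransGen_append (reflTransGen_rowInsert hr hnd.1.1 hy) (readingWord rs) []
      have h2 := reflTransGen_append (ih (fun s hs => hT s (List.mem_cons_of_mem _ hs)) hnd') []
        (rowInsert x r).1
      simp only [List.append_nil, List.nil_append, List.append_assoc, List.cons_append] at h1 h2
      simp only [readingWord, List.append_assoc]
      exact h1.trans h2

theorem reflTransGen_insertionTableau {w : List α} (hw : w.Nodup) :
    Relation.ReflTransGen ColourStep w (readingWord (insertionTableau w)) := by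
  induction w using List.reverseRecOn with
  | nil => exact Relation.ReflTransGen.refl
  | append_singleton w x ih =>
    have h1 := reflTransGen_append (ih hw.of_append_left) [] [x]
    simp only [List.nil_append] at h1
    rw [insertionTableau_concat]
    refine h1.trans (reflTransGen_tableauInsert (isTableau_insertionTableau w).1 ?_)
    refine ((flatten_insertionTableau_perm w).cons x).nodup_iff.2 ?_
    exact (List.perm_append_comm (l₁ := w) (l₂ := [x])).nodup_iff.1 hw

/-- Colouring by column index works because columns, read from the bottom, decrease. -/
theorem isDecreasingColouring_readingWord {T : List (List α)} (hT : T.Pairwise Below) {c : α → ℕ}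
    (hc : ∀ r ∈ T, ∀ (j : ℕ) a, r[j]? = some a → c a = j) (k : ℕ) :
    IsDecreasingColouring k c (readingWord T) := by
  induction T with
  | nil => exact List.Pairwise.nil
  | cons r rs ih =>
    rw [List.pairwise_cons] at hT
    unfold IsDecreasingColouring readingWord
    refine List.pairwise_append.2 ⟨ih hT.2 fun s hs => hc s (List.mem_cons_of_mem _ hs), ?_, ?_⟩
    · refine List.pairwise_iff_getElem.2 fun i j hi hj hij e => ?_
      have h1 := hc r (by simp) i _ (List.getElem?_eq_getElem hi)
      have h2 := hc r (by simp) j _ (List.getElem?_eq_getElem hj)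
      omega
    · intro a ha b hb e _
      obtain ⟨s, hs, ha⟩ := List.mem_flatten.1 ((readingWord_perm rs).mem_iff.1 ha)
      obtain ⟨i, hi⟩ := List.mem_iff_getElem?.1 ha
      obtain ⟨j, hj⟩ := List.mem_iff_getElem?.1 hb
      have h1 := hc s (List.mem_cons_of_mem _ hs) i a hi
      have h2 := hc r (by simp) j b hj
      obtain ⟨b', hb', hlt⟩ := (hT.1 s hs).getElem? hi
      rw [show i = j by omega, hj] at hb'
      exact (Option.some.inj hb') ▸ hlt

end Greene

theorem colSum_rsShape {n : ℕ} (σ : Equiv.Perm (Fin n)) (k : ℕ) :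
    colSum (rsShape σ) k =
      (((insertionTableau (permWord σ)).map List.length).map (min k)).sum := by
  unfold colSum rsShape
  change ((Multiset.filter (fun x => x ≠ 0) (((insertionTableau (permWord σ)).map List.length :
    List ℕ) : Multiset ℕ)).map (min k)).sum = _
  generalize (insertionTableau (permWord σ)).map List.length = l
  induction l with
  | nil => simp
  | cons a l ih =>
    rw [← Multiset.cons_coe]
    by_cases ha : a = 0
    · rw [Multiset.filter_cons_of_neg (p := fun x => x ≠ 0) _ (not_not.2 ha), ih]
      simp [ha]
    · rw [Multiset.filter_cons_of_pos (p := fun x => x ≠ 0) _ ha, Multiset.map_cons, Multiset.sum_cons, ih]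
      simp

/-- If `σ` has Robinson–Schensted shape `λ`, then its word has `k` disjoint decreasing
subsequences (the colours `< k`) whose total length is the size of the first `k` columns of `λ`. -/
theorem exists_decreasing_colouring {n : ℕ} (σ : Equiv.Perm (Fin n)) (k : ℕ) :
    ∃ c : Fin n → ℕ, (∀ i j, i < j → c i = c j → c i < k → σ j < σ i) ∧
      (Finset.univ.filter fun i => c i < k).card = colSum (rsShape σ) k := by
  have hT := isTableau_insertionTableau (permWord σ)
  have hcol : ∀ r ∈ insertionTableau (permWord σ), ∀ (j : ℕ) a, r[j]? = some a →
      (insertionFilling σ a).2 = j := by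
    intro r hr j a ha
    obtain ⟨i, hi, rfl⟩ := List.getElem_of_mem hr
    rw [(insertionFilling_eq_iff σ a i j).2 (by rwa [List.getD_eq_getElem _ _ hi])]
  have : Trans (Below (α := Fin n)) Below Below := ⟨Below.trans⟩
  obtain ⟨c, h1, h2⟩ := exists_colouring_of_reflTransGen
    (reflTransGen_insertionTableau (nodup_permWord σ)) (nodup_permWord σ)
    (isDecreasingColouring_readingWord (List.isChain_iff_pairwise.1 hT.2) hcol k)
  rw [countP_readingWord hcol, ← colSum_rsShape] at h2
  -- The colouring of letters becomes a colouring of positions.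
  refine ⟨fun i => c (σ i), fun i j hij => ?_, ?_⟩
  · exact List.pairwise_ofFn.1 h1 hij
  · rw [← h2, List.countP_eq_length_filter]
    have hnd := (nodup_permWord σ).filter (fun a => decide (c a < k))
    rw [← List.toFinset_card_of_nodup hnd]
    refine Finset.card_bij (fun i _ => σ i) ?_ ?_ ?_
    · intro i hi
      simpa [mem_permWord] using hi
    · intro i _ j _ h
      exact σ.injective h
    · intro a ha
      exact ⟨σ.symm a, by simpa [mem_permWord] using ha, by simp⟩


/-! ### Matrix coefficients of the permutation modules -/

section Coefficients

variable {R : Type*} [CommRing R] {n : ℕ}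

/-- The functional on `R Sym(n)` with value `1` at the permutations `σ` that carry the row
function `s` to the row function `t`, and `0` at the others. -/
noncomputable def matrixCoeff (R : Type*) [CommRing R] {n : ℕ} (s t : Fin n → ℕ) :
    SymAlg R n →ₗ[R] R :=
  Finsupp.linearCombination R
      (fun σ : Equiv.Perm (Fin n) => if ∀ i, t (σ i) = s i then (1 : R) else 0) ∘ₗ
    (MonoidAlgebra.coeffLinearEquiv R).toLinearMap

theorem matrixCoeff_single (s t : Fin n → ℕ) (σ : Equiv.Perm (Fin n)) (r : R) :
    matrixCoeff R s t (MonoidAlgebra.single σ r) = if ∀ i, t (σ i) = s i then r else 0 := by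
  simp [matrixCoeff]

theorem matrixCoeff_of (s t : Fin n → ℕ) (σ : Equiv.Perm (Fin n)) :
    matrixCoeff R s t (MonoidAlgebra.of R _ σ) = if ∀ i, t (σ i) = s i then 1 else 0 :=
  matrixCoeff_single s t σ 1

/-- The coset of `g` is encoded by the row function `i ↦ blockIndex p (g⁻¹ i)`, which depends on the
coset only. -/
theorem coeff_asAlgebraHom (p : n.Partition) (g h : Equiv.Perm (Fin n)) (x : SymAlg R n) :
    ((Representation.ofMulAction R (Equiv.Perm (Fin n))
      (Equiv.Perm (Fin n) ⧸ youngSubgroup p)).asAlgebraHom x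
        (MonoidAlgebra.single (QuotientGroup.mk g) 1)).coeff (QuotientGroup.mk h) =
      matrixCoeff R (fun i => blockIndex p (g⁻¹ i)) (fun i => blockIndex p (h⁻¹ i)) x := by
  classical
  induction x using MonoidAlgebra.induction_linear with
  | zero => simp
  | add x y hx hy => simp [hx, hy]
  | single σ r =>
    rw [Representation.asAlgebraHom_single, LinearMap.smul_apply,
      Representation.ofMulAction_single, matrixCoeff_single, MonoidAlgebra.coeff_smul_apply,
      MonoidAlgebra.coeff_single, Finsupp.single_apply]
    have e : (σ • (QuotientGroup.mk g : Equiv.Perm (Fin n) ⧸ youngSubgroup p) =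
        QuotientGroup.mk h) ↔ ∀ i, blockIndex p (h⁻¹ (σ i)) = blockIndex p (g⁻¹ i) := by
      rw [MulAction.Quotient.smul_mk, eq_comm, QuotientGroup.eq, mem_youngSubgroup_iff]
      constructor
      · intro H i
        simpa using H (g⁻¹ i)
      · intro H i
        simpa using H (g i)
    simp only [e]
    split_ifs <;> simp

/-- Row functions with the row lengths of `p`. -/
def HasShape (p : n.Partition) (s : Fin n → ℕ) : Prop :=
  ∀ r, (Finset.univ.filter fun i => s i = r).card = part p r

theorem HasShape.exists_perm {p : n.Partition} {s : Fin n → ℕ} (hs : HasShape p s) :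
    ∃ g : Equiv.Perm (Fin n), s = fun i => blockIndex p (g⁻¹ i) := by
  obtain ⟨e, he⟩ := exists_perm_comp_eq s (blockIndex p) fun r => by rw [hs, card_blockIndex_eq]
  exact ⟨e⁻¹, funext fun i => by simp [he]⟩

theorem hasShape_blockIndex (p : n.Partition) (g : Equiv.Perm (Fin n)) :
    HasShape p fun i => blockIndex p (g⁻¹ i) := by
  intro r
  rw [← card_blockIndex_eq]
  refine Finset.card_bij (fun i _ => g⁻¹ i) (fun i hi => by simpa using hi)
    (fun i _ j _ h => g⁻¹.injective h) fun i hi => ⟨g i, by simpa using hi, by simp⟩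

theorem HasShape.card_lt {p : n.Partition} {s : Fin n → ℕ} (hs : HasShape p s) (k : ℕ) :
    (Finset.univ.filter fun i => s i < k).card = rowSum p k := by
  rw [rowSum_eq_sum_part, Finset.card_eq_sum_card_fiberwise (f := s) (t := Finset.range k)]
  · refine Finset.sum_congr rfl fun r hr => ?_
    rw [← hs r, Finset.filter_filter]
    refine congrArg Finset.card (Finset.filter_congr fun i _ => ?_)
    have := Finset.mem_range.1 hr
    constructor
    · exact fun h => h.2
    · intro h; exact ⟨h ▸ this, h⟩
  · intro i hi
    simpa using hi

/-- `x` annihilates `M(p)` if and only if all its matrix coefficients vanish. -/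
theorem smul_permModule_eq_zero_iff (p : n.Partition) (x : SymAlg R n) :
    (∀ m : PermModule R p, x • m = 0) ↔
      ∀ s t, HasShape p s → HasShape p t → matrixCoeff R s t x = 0 := by
  let ρ := Representation.ofMulAction R (Equiv.Perm (Fin n))
      (Equiv.Perm (Fin n) ⧸ youngSubgroup p)
  constructor
  · intro H s t hs ht
    obtain ⟨g, rfl⟩ := hs.exists_perm
    obtain ⟨h, rfl⟩ := ht.exists_perm
    rw [← coeff_asAlgebraHom]
    have := congrArg ρ.asModuleEquiv
      (H (ρ.asModuleEquiv.symm (MonoidAlgebra.single (QuotientGroup.mk g) 1)))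
    rw [Representation.asModuleEquiv_map_smul, LinearEquiv.apply_symm_apply, map_zero] at this
    rw [this]
    rfl
  · intro H m
    apply ρ.asModuleEquiv.injective
    rw [Representation.asModuleEquiv_map_smul, map_zero]
    generalize ρ.asModuleEquiv m = m'
    induction m' using MonoidAlgebra.induction_linear with
    | zero => simp
    | add a b ha hb => rw [map_add, ha, hb, add_zero]
    | single q r =>
      have e : (MonoidAlgebra.single q r : MonoidAlgebra R (Equiv.Perm (Fin n) ⧸ youngSubgroup p)) =
          r • MonoidAlgebra.single q 1 := by simp
      rw [e, map_smul]
      have h0 : ρ.asAlgebraHom x (MonoidAlgebra.single q 1) = 0 := by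
        refine MonoidAlgebra.ext (Finsupp.ext fun q' => ?_)
        induction q using QuotientGroup.induction_on with
        | H g =>
          induction q' using QuotientGroup.induction_on with
          | H h =>
            rw [coeff_asAlgebraHom]
            exact H _ _ (hasShape_blockIndex p g) (hasShape_blockIndex p h)
      rw [h0, smul_zero]

/-! ### Signed sums over Young subgroups -/

/-- The signed sum of the permutations that preserve the fibres of `f`. -/
noncomputable def signedSum (R : Type*) [CommRing R] {n : ℕ} (f : Fin n → ℕ) : SymAlg R n :=
  ∑ κ : Equiv.Perm (Fin n) with ∀ i, f (κ i) = f i,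
    ((Equiv.Perm.sign κ : ℤˣ) : ℤ) • MonoidAlgebra.of R _ κ

theorem matrixCoeff_signedSum_mul (f s t : Fin n → ℕ) (w : Equiv.Perm (Fin n)) :
    matrixCoeff R s t (signedSum R f * MonoidAlgebra.of R _ w) =
      ∑ κ : Equiv.Perm (Fin n) with ∀ i, f (κ i) = f i,
        ((Equiv.Perm.sign κ : ℤˣ) : ℤ) • (if ∀ i, t (κ (w i)) = s i then (1 : R) else 0) := by
  unfold signedSum
  rw [Finset.sum_mul, map_sum]
  refine Finset.sum_congr rfl fun κ _ => ?_
  rw [smul_mul_assoc, ← map_mul, map_zsmul, matrixCoeff_of]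
  rfl

theorem exists_of_matrixCoeff_ne_zero {f s t : Fin n → ℕ} {w : Equiv.Perm (Fin n)}
    (h : matrixCoeff R s t (signedSum R f * MonoidAlgebra.of R _ w) ≠ 0) :
    ∃ κ : Equiv.Perm (Fin n), (∀ i, f (κ i) = f i) ∧ ∀ i, t (κ (w i)) = s i := by
  rw [matrixCoeff_signedSum_mul] at h
  obtain ⟨κ, hκ, hne⟩ := Finset.exists_ne_zero_of_sum_ne_zero h
  refine ⟨κ, (Finset.mem_filter.1 hκ).2, ?_⟩
  by_contra hc
  rw [if_neg hc, smul_zero] at hne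
  exact hne rfl

/-- If `i ≠ j` agree under both `f` and `t`, then `κ ↦ (i j) κ` is a sign-reversing involution on
the terms, and the sum is zero. -/
theorem injective_left_of_matrixCoeff_ne_zero {f s t : Fin n → ℕ} {w : Equiv.Perm (Fin n)}
    (h : matrixCoeff R s t (signedSum R f * MonoidAlgebra.of R _ w) ≠ 0) {i j : Fin n}
    (hf : f i = f j) (ht : t i = t j) : i = j := by
  by_contra hij
  apply h
  rw [matrixCoeff_signedSum_mul]
  have hfs : ∀ a, f (Equiv.swap i j a) = f a := by
    intro a
    rw [Equiv.swap_apply_def]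
    split_ifs with h1 h2
    · rw [h1, hf]
    · rw [h2, hf]
    · rfl
  have hts : ∀ a, t (Equiv.swap i j a) = t a := by
    intro a
    rw [Equiv.swap_apply_def]
    split_ifs with h1 h2
    · rw [h1, ht]
    · rw [h2, ht]
    · rfl
  refine Finset.sum_involution (fun κ _ => Equiv.swap i j * κ) ?_ ?_ ?_ ?_
  · intro κ _
    simp only [Equiv.Perm.sign_mul, Equiv.Perm.sign_swap hij, Equiv.Perm.mul_apply, hts]
    split_ifs <;> simp
  · intro κ _ _ e
    have : Equiv.swap i j = 1 := by simpa using e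
    exact hij (Equiv.swap_eq_one_iff.1 this)
  · intro κ hκ
    simp only [Finset.mem_filter, Finset.mem_univ, true_and, Equiv.Perm.mul_apply, hfs] at hκ ⊢
    exact hκ
  · intro κ _
    rw [← mul_assoc, Equiv.swap_mul_self, one_mul]

theorem injective_right_of_matrixCoeff_ne_zero {f s t : Fin n → ℕ} {w : Equiv.Perm (Fin n)}
    (h : matrixCoeff R s t (signedSum R f * MonoidAlgebra.of R _ w) ≠ 0) {i j : Fin n}
    (hf : f (w i) = f (w j)) (hs : s i = s j) : i = j := by
  obtain ⟨κ, h1, h2⟩ := exists_of_matrixCoeff_ne_zero h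
  have := injective_left_of_matrixCoeff_ne_zero h (i := κ (w i)) (j := κ (w j))
    (by rw [h1, h1, hf]) (by rw [h2, h2, hs])
  exact w.injective (κ.injective this)

theorem dagger_of (σ : Equiv.Perm (Fin n)) : dagger R n (MonoidAlgebra.of R _ σ) =
    ((Equiv.Perm.sign σ : ℤˣ) : ℤ) • MonoidAlgebra.of R _ σ := by
  unfold dagger
  rw [MonoidAlgebra.lift_of]
  rfl

theorem dagger_youngSum (p : n.Partition) :
    dagger R n (youngSum R p) = signedSum R (blockIndex p) := by
  classical
  unfold youngSum signedSum
  rw [map_sum]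
  simp only [dagger_of]
  refine Finset.sum_congr (Finset.filter_congr fun κ _ => mem_youngSubgroup_iff p κ) fun _ _ => rfl

/-- On each fibre of `f` the function `t` is injective, so it takes values below `k` at most `k`
times. -/
theorem card_filter_lt_le (S : Finset (Fin n)) (t f : Fin n → ℕ) (k : ℕ)
    (h : ∀ i ∈ S, ∀ j ∈ S, f i = f j → t i = t j → i = j) :
    (S.filter fun i => t i < k).card ≤
      ∑ c ∈ S.image f, min k (S.filter fun i => f i = c).card := by
  rw [Finset.card_eq_sum_card_fiberwise (f := f) (t := S.image f)]
  · refine Finset.sum_le_sum fun c _ => le_min ?_ ?_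
    · refine (Finset.card_le_card_of_injOn (t := Finset.range k) t ?_ ?_).trans_eq
        (Finset.card_range k)
      · intro i hi
        have hi' := Finset.mem_filter.1 hi
        exact Finset.mem_coe.2 (Finset.mem_range.2 (Finset.mem_filter.1 hi'.1).2)
      · intro i hi j hj hij
        simp only [Finset.coe_filter, Finset.mem_filter, Set.mem_ofPred_eq] at hi hj
        exact h i hi.1.1 j hj.1.1 (hi.2.trans hj.2.symm) hij
    · refine Finset.card_le_card fun i hi => ?_
      simp only [Finset.mem_filter] at hi ⊢
      exact ⟨hi.1.1, hi.2⟩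
  · intro i hi
    exact Finset.mem_coe.2 (Finset.mem_image_of_mem f (Finset.mem_filter.1 hi).1)

/-- If the signed sum over `Sym(p)` does not annihilate `M(q)`, then `q` is dominated by the
transpose of `p`. -/
theorem le_transpose_of_matrixCoeff_ne_zero {p q : n.Partition} {s t : Fin n → ℕ}
    (ht : HasShape q t) (h : matrixCoeff R s t (signedSum R (blockIndex p)) ≠ 0) :
    q ≤ transpose p := by
  intro k
  rw [← mul_one (signedSum R (blockIndex p)), ← map_one (MonoidAlgebra.of R _)] at h
  have h1 := card_filter_lt_le Finset.univ t (blockIndex p) k fun i _ j _ hf ht =>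
    injective_left_of_matrixCoeff_ne_zero h hf ht
  rw [ht.card_lt] at h1
  refine h1.trans ?_
  simp only [card_blockIndex_eq]
  rw [rowSum_transpose]
  unfold colSum
  -- Large enough both to reach all parts and to exceed every block index.
  let N := n + (Finset.univ.image (blockIndex p)).sup id + 1
  rw [sum_map_parts p (min k) (by simp) (N := N) (by simp only [N]; omega)]
  refine Finset.sum_le_sum_of_subset fun c hc => ?_
  have := Finset.le_sup (f := id) hc
  simp only [id] at this
  rw [Finset.mem_range]
  simp only [N]
  omega

theorem dagger_mem_annihilator {Γ : Set n.Partition} (hΓ : IsUpperSet Γ) {q : n.Partition}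
    (hq : q ∈ Γ) {x : SymAlg R n} (hx : x ∈ youngIdeal R (transpose '' Γ)ᶜ)
    (m : PermModule R q) : dagger R n x • m = 0 := by
  revert m
  unfold youngIdeal at hx
  induction hx using TwoSidedIdeal.span_induction with
  | mem x hx =>
    obtain ⟨p, hp, rfl⟩ := hx
    rw [dagger_youngSum, smul_permModule_eq_zero_iff]
    intro s t _ ht
    by_contra hne
    exact hp ⟨transpose p, hΓ (le_transpose_of_matrixCoeff_ne_zero ht hne) hq,
      transpose_transpose p⟩
  | zero => intro m; rw [map_zero, zero_smul]
  | add x y _ _ hx hy => intro m; rw [map_add, add_smul, hx, hy, add_zero]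
  | neg x _ hx => intro m; rw [map_neg, neg_smul, hx, neg_zero]
  | left_absorb a x _ hx => intro m; rw [map_mul, mul_smul, hx, smul_zero]
  | right_absorb b x _ hx => intro m; rw [map_mul, mul_smul, hx]

end Coefficients


section Spanning

variable {R : Type*} [CommRing R] {n : ℕ}

/-! ### The ideal `I_R(Δ)^†` and straightening -/

theorem dagger_dagger (x : SymAlg R n) : dagger R n (dagger R n x) = x := by
  induction x using MonoidAlgebra.induction_linear with
  | zero => simp
  | add x y hx hy => rw [map_add, map_add, hx, hy]
  | single σ r =>
    have e : (MonoidAlgebra.single σ r : SymAlg R n) = r • MonoidAlgebra.of R _ σ := by simp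
    rw [e, map_smul, map_smul, dagger_of, map_zsmul, dagger_of, smul_smul,
      ← Units.val_mul, Int.units_mul_self, Units.val_one, one_smul]

/-- `I_R(Δ)^†` as an `R`-submodule of `R Sym(n)`. -/
noncomputable def daggerIdeal (R : Type*) [CommRing R] {n : ℕ} (Δ : Set n.Partition) :
    Submodule R (SymAlg R n) where
  carrier := dagger R n '' (youngIdeal R Δ : Set (SymAlg R n))
  add_mem' := by
    rintro _ _ ⟨x, hx, rfl⟩ ⟨y, hy, rfl⟩
    exact ⟨x + y, (youngIdeal R Δ).add_mem hx hy, map_add _ _ _⟩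
  zero_mem' := ⟨0, (youngIdeal R Δ).zero_mem, map_zero _⟩
  smul_mem' := by
    rintro r _ ⟨x, hx, rfl⟩
    refine ⟨r • x, ?_, map_smul _ _ _⟩
    rw [Algebra.smul_def]
    exact (youngIdeal R Δ).mul_mem_left _ _ hx

theorem mul_mem_daggerIdeal {Δ : Set n.Partition} (a b : SymAlg R n) {x : SymAlg R n}
    (hx : x ∈ daggerIdeal R Δ) : a * x * b ∈ daggerIdeal R Δ := by
  obtain ⟨x, hx, rfl⟩ := hx
  refine ⟨dagger R n a * x * dagger R n b, (youngIdeal R Δ).mul_mem_right _ _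
    ((youngIdeal R Δ).mul_mem_left _ _ hx), ?_⟩
  rw [map_mul, map_mul, dagger_dagger, dagger_dagger]

theorem signedSum_eq_conj {f f' : Fin n → ℕ} (g : Equiv.Perm (Fin n))
    (h : ∀ i j, f (g i) = f (g j) ↔ f' i = f' j) :
    signedSum R f = MonoidAlgebra.of R _ g * signedSum R f' * MonoidAlgebra.of R _ g⁻¹ := by
  unfold signedSum
  rw [Finset.mul_sum, Finset.sum_mul]
  symm
  refine Finset.sum_bij (fun κ _ => g * κ * g⁻¹) ?_ ?_ ?_ ?_
  · intro κ hκ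
    simp only [Finset.mem_filter, Finset.mem_univ, true_and] at hκ ⊢
    intro i
    have := (h (κ (g⁻¹ i)) (g⁻¹ i)).2 (hκ _)
    simpa using this
  · intro κ _ κ' _ e
    simpa using e
  · intro κ hκ
    simp only [Finset.mem_filter, Finset.mem_univ, true_and] at hκ
    refine ⟨g⁻¹ * κ * g, ?_, by group⟩
    simp only [Finset.mem_filter, Finset.mem_univ, true_and]
    intro i
    rw [← h]
    simpa using hκ (g i)
  · intro κ _
    rw [mul_smul_comm, smul_mul_assoc, ← map_mul, ← map_mul]
    congr 2
    rw [Equiv.Perm.sign_mul, Equiv.Perm.sign_mul, Equiv.Perm.sign_inv, mul_right_comm,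
      Int.units_mul_self, one_mul]

theorem signedSum_mem_daggerIdeal {Δ : Set n.Partition} {p : n.Partition} (hp : p ∈ Δ)
    {f : Fin n → ℕ} (g : Equiv.Perm (Fin n))
    (h : ∀ i j, f (g i) = f (g j) ↔ blockIndex p i = blockIndex p j) :
    signedSum R f ∈ daggerIdeal R Δ := by
  rw [signedSum_eq_conj g h]
  refine mul_mem_daggerIdeal _ _ ⟨youngSum R p, ?_, dagger_youngSum p⟩
  exact TwoSidedIdeal.subset_span ⟨p, hp, rfl⟩

/-- The first point moved by `κ` must move up, since everything below it is fixed; there the two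
words first differ. -/
theorem toLex_mul_lt {σ κ : Equiv.Perm (Fin n)} (hκ : κ ≠ 1)
    (h : ∀ i, i < κ i → σ (κ i) < σ i) :
    toLex (fun i => (σ * κ) i) < toLex (fun i => σ i) := by
  classical
  have hne : (Finset.univ.filter fun i => κ i ≠ i).Nonempty := by
    by_contra hc
    rw [Finset.not_nonempty_iff_eq_empty, Finset.filter_eq_empty_iff] at hc
    exact hκ (Equiv.ext fun i => not_not.1 (hc (Finset.mem_univ i)))
  obtain ⟨i, hi, hmin⟩ := Finset.exists_min_image _ id hne
  have hfix : ∀ j < i, κ j = j := by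
    intro j hj
    by_contra hc
    exact absurd (hmin j (by simpa using hc)) (not_le.2 hj)
  have hi' : κ i ≠ i := (Finset.mem_filter.1 hi).2
  have hlt : i < κ i := by
    rcases lt_trichotomy i (κ i) with h1 | h1 | h1
    · exact h1
    · exact absurd h1.symm hi'
    · exact absurd (κ.injective (hfix _ h1)) hi'
  refine ⟨i, fun j hj => ?_, h i hlt⟩
  change σ (κ j) = σ j
  rw [hfix j hj]

/-- The `k` decreasing subsequences give a block partition `p` whose first `k` rows exceed `colSum μ
k`, whereas `rowSum (transpose ν) k = colSum ν k ≤ colSum μ k` for all `ν ∈ Γ`. The common lower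
bound `μ` lets a single `k` serve every `ν`. -/
theorem exists_shape_colouring {Γ : Set n.Partition} {μ : n.Partition} (hμ : ∀ q ∈ Γ, μ ≤ q)
    {σ : Equiv.Perm (Fin n)} (hσ : ¬ μ ≤ rsShape σ) :
    ∃ f : Fin n → ℕ, (∀ i j, i < j → f i = f j → σ j < σ i) ∧
      signedSum R f ∈ daggerIdeal R (transpose '' Γ)ᶜ := by
  have hk : ∃ k, colSum μ k < colSum (rsShape σ) k := by
    by_contra! hc
    exact hσ (le_of_colSum_le hc)
  obtain ⟨k, hk⟩ := hk
  obtain ⟨c, hdec, hcard⟩ := exists_decreasing_colouring σ k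
  -- Positions outside the `k` subsequences get colours of their own, so that they are fixed by the
  -- block-preserving permutations.
  let f : Fin n → ℕ := fun i => if c i < k then c i else k + i
  have hfk : ∀ i, f i < k ↔ c i < k := by
    intro i
    simp only [f]
    split_ifs with h <;> simp [h]
  obtain ⟨p, g, hg, hrow⟩ := exists_partition_of_fun f
  refine ⟨f, fun i j hij hf => ?_, signedSum_mem_daggerIdeal ?_ g hg⟩
  · by_cases hi : c i < k
    · have hj : c j < k := (hfk j).1 (hf ▸ (hfk i).2 hi)
      simp only [f, if_pos hi, if_pos hj] at hf
      exact hdec i j hij hf hi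
    · have hj : ¬ c j < k := fun h => hi ((hfk i).1 (hf ▸ (hfk j).2 h))
      simp only [f, if_neg hi, if_neg hj] at hf
      have : (i : ℕ) < j := hij
      omega
  · rintro ⟨ν, hν, rfl⟩
    have h1 := hrow k
    simp only [hfk] at h1
    rw [hcard, rowSum_transpose] at h1
    have h2 := colSum_le_of_le (hμ ν hν) k
    omega

theorem of_mem_sup {Γ : Set n.Partition} {μ : n.Partition} (hμ : ∀ q, q ∈ Γ ↔ μ ≤ q)
    (σ : Equiv.Perm (Fin n)) :
    MonoidAlgebra.of R _ σ ∈ shapeSpan R Γ ⊔ daggerIdeal R (transpose '' Γ)ᶜ := by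
  have hwf : WellFounded (fun σ τ : Equiv.Perm (Fin n) =>
      toLex (fun i => σ i) < toLex (fun i => τ i)) :=
    InvImage.wf (fun σ : Equiv.Perm (Fin n) => toLex (fun i => σ i)) wellFounded_lt
  induction σ using hwf.induction with
  | h σ ih =>
    by_cases hσ : rsShape σ ∈ Γ
    · exact Submodule.mem_sup_left (Submodule.subset_span ⟨σ, hσ, rfl⟩)
    · obtain ⟨f, hf, hmem⟩ := exists_shape_colouring (R := R) (fun q hq => (hμ q).1 hq)
        (fun h => hσ ((hμ _).2 h))
      have h1 := mul_mem_daggerIdeal (MonoidAlgebra.of R _ σ) 1 hmem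
      rw [mul_one] at h1
      -- The term `κ = 1` is `σ` itself; the others have lexicographically smaller words.
      have h2 : MonoidAlgebra.of R _ σ * signedSum R f = MonoidAlgebra.of R _ σ +
          ∑ κ ∈ (Finset.univ.filter fun κ : Equiv.Perm (Fin n) => ∀ i, f (κ i) = f i).erase 1,
            ((Equiv.Perm.sign κ : ℤˣ) : ℤ) • MonoidAlgebra.of R _ (σ * κ) := by
        unfold signedSum
        rw [Finset.mul_sum, ← Finset.add_sum_erase (a := 1) _ _ (by simp)]
        congr 1
        · simp
        · exact Finset.sum_congr rfl fun κ _ => by rw [mul_smul_comm, ← map_mul]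
      rw [eq_sub_of_add_eq h2.symm]
      refine Submodule.sub_mem _ (Submodule.mem_sup_right h1) (Submodule.sum_mem _ fun κ hκ => ?_)
      rw [Finset.mem_erase, Finset.mem_filter] at hκ
      exact zsmul_mem (ih _ (toLex_mul_lt hκ.1 fun i hi => hf i _ hi (hκ.2.2 i).symm)) _

theorem shapeSpan_sup_daggerIdeal {Γ : Set n.Partition} {μ : n.Partition}
    (hμ : ∀ q, q ∈ Γ ↔ μ ≤ q) : shapeSpan R Γ ⊔ daggerIdeal R (transpose '' Γ)ᶜ = ⊤ := by
  rw [eq_top_iff]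
  intro x _
  induction x using MonoidAlgebra.induction_linear with
  | zero => exact Submodule.zero_mem _
  | add x y hx hy => exact Submodule.add_mem _ (hx trivial) (hy trivial)
  | single σ r =>
    have e : (MonoidAlgebra.single σ r : SymAlg R n) = r • MonoidAlgebra.of R _ σ := by simp
    rw [e]
    exact Submodule.smul_mem _ _ (of_mem_sup hμ σ)

end Spanning

/-! ### Unitriangularity of the matrix coefficients -/

section Triangular

variable {R : Type*} [CommRing R] {n : ℕ}

/-- Dominance of row functions: each prefix has at least as many entries in the first `k` rows. -/
def RowLE (s u : Fin n → ℕ) : Prop :=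
  ∀ m k : ℕ, ((Finset.univ.filter fun i : Fin n => (i : ℕ) < m).filter fun i => s i < k).card ≤
    ((Finset.univ.filter fun i : Fin n => (i : ℕ) < m).filter fun i => u i < k).card

theorem RowLE.trans {s t u : Fin n → ℕ} (h : RowLE s t) (h' : RowLE t u) : RowLE s u :=
  fun m k => (h m k).trans (h' m k)

/-- Passing from prefix `i` to `i + 1` changes the count by `1` exactly when the value at `i` is
below `k`, so the counts determine the function. -/
theorem RowLE.antisymm {s u : Fin n → ℕ} (h : RowLE s u) (h' : RowLE u s) : s = u := by
  have heq := fun m k => le_antisymm (h m k) (h' m k)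
  have hstep : ∀ (s : Fin n → ℕ) (i : Fin n) (k : ℕ),
      ((Finset.univ.filter fun j : Fin n => (j : ℕ) < i + 1).filter fun j => s j < k).card =
      ((Finset.univ.filter fun j : Fin n => (j : ℕ) < i).filter fun j => s j < k).card +
        if s i < k then 1 else 0 := by
    intro s i k
    have e : (Finset.univ.filter fun j : Fin n => (j : ℕ) < i + 1) =
        insert i (Finset.univ.filter fun j : Fin n => (j : ℕ) < i) := by
      ext j
      simp only [Finset.mem_filter, Finset.mem_univ, true_and, Finset.mem_insert, Fin.ext_iff]
      omega
    rw [e, Finset.filter_insert]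
    split_ifs
    · rw [Finset.card_insert_of_notMem (by simp)]
    · rfl
  funext i
  have key : ∀ k, s i < k ↔ u i < k := by
    intro k
    have h1 := heq (i + 1) k
    rw [hstep, hstep, heq i k] at h1
    split_ifs at h1 with h2 h3 h3
    · exact ⟨fun _ => h3, fun _ => h2⟩
    · omega
    · omega
    · exact ⟨fun h => absurd h h2, fun h => absurd h h3⟩
  have h1 := key (s i + 1)
  have h2 := key (u i + 1)
  omega

/-- If a column of `v` holds `l` numbers below `m`, at most `min k l` of them have `t < k`. The rows
of `v` attain this bound, since these numbers fill the top `l` boxes of the column. -/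
theorem IsStandardFilling.rowLE {v : Fin n → ℕ × ℕ} (hv : IsStandardFilling v) {t : Fin n → ℕ}
    (ht : ∀ i j, (v i).2 = (v j).2 → t i = t j → i = j) : RowLE t fun i => (v i).1 := by
  intro m k
  set S := Finset.univ.filter fun i : Fin n => (i : ℕ) < m with hS
  refine (card_filter_lt_le S t (fun i => (v i).2) k fun i _ j _ h1 h2 => ht i j h1 h2).trans ?_
  rw [Finset.card_eq_sum_card_fiberwise (s := S.filter fun i => (v i).1 < k)
    (f := fun i => (v i).2) (t := S.image fun i => (v i).2)]
  · refine Finset.sum_le_sum fun c _ => ?_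
    -- Boxes above the box of `i` hold smaller numbers, hence again members of `S`.
    have hdown : ∀ i ∈ S, ∀ r, (v i).2 = c → r ≤ (v i).1 → ∃ j ∈ S, v j = (r, c) := by
      intro i
      induction i using WellFoundedLT.induction with
      | ind i ih =>
        intro hi r hc hr
        rcases hr.eq_or_lt with rfl | hr
        · exact ⟨i, hi, Prod.ext rfl hc⟩
        · obtain ⟨r', hr'⟩ : ∃ r', (v i).1 = r' + 1 := ⟨(v i).1 - 1, by omega⟩
          obtain ⟨j, hj, hvj⟩ := hv.2 i r' c (Prod.ext hr' hc)
          refine ih j hj ?_ r (by rw [hvj]) (by rw [hvj]; simp only; omega)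
          simp only [hS, Finset.mem_filter, Finset.mem_univ, true_and] at hi ⊢
          have : (j : ℕ) < i := hj
          omega
    by_cases hall : ∀ i ∈ S, (v i).2 = c → (v i).1 < k
    · refine (min_le_right _ _).trans (Finset.card_le_card fun i hi => ?_)
      simp only [Finset.mem_filter] at hi ⊢
      exact ⟨⟨hi.1, hall i hi.1 hi.2⟩, hi.2⟩
    · push Not at hall
      obtain ⟨i, hi, hc, hki⟩ := hall
      refine (min_le_left _ _).trans ?_
      have hex : ∀ r, r < k → ∃ j ∈ S, v j = (r, c) := fun r hr => hdown i hi r hc (by omega)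
      calc k = (Finset.range k).card := (Finset.card_range k).symm
        _ ≤ (((S.filter fun i => (v i).1 < k).filter fun i => (v i).2 = c).image
              fun i => (v i).1).card := by
            refine Finset.card_le_card fun r hr => ?_
            obtain ⟨j, hj, hvj⟩ := hex r (Finset.mem_range.1 hr)
            refine Finset.mem_image.2 ⟨j, ?_, by rw [hvj]⟩
            simp only [Finset.mem_filter, hvj]
            exact ⟨⟨hj, Finset.mem_range.1 hr⟩, trivial⟩
        _ ≤ _ := Finset.card_image_le
  · intro i hi
    exact Finset.mem_coe.2 (Finset.mem_image_of_mem _ (Finset.mem_filter.1 hi).1)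

theorem exists_perm_fillings (σ : Equiv.Perm (Fin n)) :
    ∃ w : Equiv.Perm (Fin n), ∀ i, insertionFilling σ (w i) = recordingFilling σ i := by
  have h : ∀ i, ∃ a, insertionFilling σ a = recordingFilling σ i := fun i =>
    (lt_part_iff_insertionFilling σ _ _).1 ((lt_part_iff_recordingFilling σ _ _).2 ⟨i, rfl⟩)
  choose w hw using h
  have hinj : Function.Injective w := fun i j hij =>
    (isStandardFilling_recordingFilling σ).1 (by rw [← hw, ← hw, hij])
  exact ⟨Equiv.ofBijective w (Finite.injective_iff_bijective.1 hinj), hw⟩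

/-- The functional attached to `σ` by its insertion and recording tableaux. -/
noncomputable def rsCoeff (R : Type*) [CommRing R] {n : ℕ} (σ : Equiv.Perm (Fin n)) :
    SymAlg R n →ₗ[R] R :=
  matrixCoeff R (fun i => (recordingFilling σ i).1) (fun a => (insertionFilling σ a).1)

/-- The element of `R Sym(n)` attached to `σ` by its insertion and recording tableaux: a signed
column sum times the permutation that carries the recording to the insertion tableau. -/
noncomputable def rsElement (R : Type*) [CommRing R] {n : ℕ} (σ : Equiv.Perm (Fin n)) :
    SymAlg R n :=
  signedSum R (fun a => (insertionFilling σ a).2) *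
    MonoidAlgebra.of R _ (exists_perm_fillings σ).choose

/-- A contributing `κ` preserves both the row and the column of every letter, so only `κ = 1`
contributes. -/
theorem rsCoeff_rsElement_self (σ : Equiv.Perm (Fin n)) : rsCoeff R σ (rsElement R σ) = 1 := by
  unfold rsCoeff rsElement
  have hw := (exists_perm_fillings σ).choose_spec
  set w := (exists_perm_fillings σ).choose
  rw [matrixCoeff_signedSum_mul, Finset.sum_eq_single 1]
  · rw [if_pos fun i => by simp [hw]]
    simp
  · intro κ hκ hne
    rw [if_neg, smul_zero]
    intro h
    apply hne
    refine Equiv.ext fun a => (isStandardFilling_insertionFilling σ).1 (Prod.ext ?_ ?_)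
    · have := h (w⁻¹ a)
      rw [← hw] at this
      simpa using this
    · exact (Finset.mem_filter.1 hκ).2 a
  · intro h
    simp at h

/-- A nonzero coefficient means that no column of either tableau of `τ` repeats a row value of the
corresponding tableau of `σ`, which is the hypothesis of `IsStandardFilling.rowLE`. -/
theorem rowLE_of_rsCoeff_ne_zero {σ τ : Equiv.Perm (Fin n)}
    (h : rsCoeff R σ (rsElement R τ) ≠ 0) :
    RowLE (fun i => (recordingFilling σ i).1) (fun i => (recordingFilling τ i).1) ∧
      RowLE (fun a => (insertionFilling σ a).1) (fun a => (insertionFilling τ a).1) := by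
  unfold rsCoeff rsElement at h
  have hw := (exists_perm_fillings τ).choose_spec
  constructor
  · refine (isStandardFilling_recordingFilling τ).rowLE fun i j h1 h2 => ?_
    exact injective_right_of_matrixCoeff_ne_zero h (by simp only [hw, h1]) h2
  · exact (isStandardFilling_insertionFilling τ).rowLE fun i j h1 h2 =>
      injective_left_of_matrixCoeff_ne_zero h h1 h2

/-- The matrix of `rsCoeff` against `rsElement` is unitriangular for a partial order on `S`, so the
unit vectors are reached one after another by well-founded induction. -/
theorem surjective_rsCoeff (S : Set (Equiv.Perm (Fin n))) :
    Function.Surjective (LinearMap.pi fun σ : S => rsCoeff R (σ : Equiv.Perm (Fin n))) := by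
  classical
  set Φ := LinearMap.pi fun σ : S => rsCoeff R (σ : Equiv.Perm (Fin n)) with hΦ
  let rel : S → S → Prop := fun σ τ =>
    (RowLE (fun i => (recordingFilling σ.1 i).1) (fun i => (recordingFilling τ.1 i).1) ∧
      RowLE (fun a => (insertionFilling σ.1 a).1) (fun a => (insertionFilling τ.1 a).1)) ∧ σ ≠ τ
  have hanti : ∀ σ τ, rel σ τ → ¬ rel τ σ := by
    -- Injectivity of Robinson–Schensted enters here: equal row functions force `σ = τ`.
    rintro σ τ ⟨⟨h1, h2⟩, hne⟩ ⟨⟨h3, h4⟩, -⟩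
    exact hne (Subtype.ext (eq_of_fillings_eq (congrFun (h2.antisymm h4))
      (congrFun (h1.antisymm h3))))
  have : IsTrans S rel := ⟨fun σ τ υ h h' =>
    ⟨⟨h.1.1.trans h'.1.1, h.1.2.trans h'.1.2⟩, fun e => hanti σ τ h (e ▸ h')⟩⟩
  have : Std.Irrefl rel := ⟨fun σ h => h.2 rfl⟩
  have hwf : WellFounded rel := Finite.wellFounded_of_trans_of_irrefl rel
  have hsingle : ∀ τ : S, (Pi.single τ 1 : S → R) ∈ LinearMap.range Φ := by
    intro τ
    induction τ using hwf.induction with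
    | h τ ih =>
      have h1 : (Pi.single τ 1 : S → R) = Φ (rsElement R τ.1) -
          ∑ σ ∈ Finset.univ.erase τ, rsCoeff R σ.1 (rsElement R τ.1) • (Pi.single σ 1 : S → R) := by
        rw [eq_sub_iff_add_eq]
        have h2 : Φ (rsElement R τ.1) =
            ∑ σ : S, rsCoeff R σ.1 (rsElement R τ.1) • (Pi.single σ 1 : S → R) := by
          funext σ
          simp [hΦ, Finset.sum_apply, Pi.single_apply]
        rw [h2, ← Finset.add_sum_erase _ _ (Finset.mem_univ τ), rsCoeff_rsElement_self, one_smul]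
      rw [h1]
      refine Submodule.sub_mem _ ⟨_, rfl⟩ (Submodule.sum_mem _ fun σ hσ => ?_)
      by_cases h0 : rsCoeff R σ.1 (rsElement R τ.1) = 0
      · rw [h0, zero_smul]
        exact Submodule.zero_mem _
      · exact Submodule.smul_mem _ _
          (ih σ ⟨rowLE_of_rsCoeff_ne_zero h0, (Finset.mem_erase.1 hσ).1⟩)
  intro y
  have hy : y = ∑ σ : S, y σ • (Pi.single σ 1 : S → R) := by
    funext σ
    simp [Finset.sum_apply, Pi.single_apply]
  rw [hy]
  exact Submodule.sum_mem (LinearMap.range Φ) fun σ _ => Submodule.smul_mem _ _ (hsingle σ)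

end Triangular


/-! ### Independence modulo the annihilator and the main theorem -/

section Conclusion

variable {R : Type*} [CommRing R] {n : ℕ}

theorem mem_annihilator_iff {Γ : Set n.Partition} {M : Type*} [AddCommGroup M]
    [Module (SymAlg R n) M] (hM : IsYoungPermModuleOfType R Γ M) (x : SymAlg R n) :
    x ∈ Module.annihilator (SymAlg R n) M ↔ ∀ p ∈ Γ, ∀ m : PermModule R p, x • m = 0 := by
  classical
  obtain ⟨u, hu, ⟨e⟩⟩ := hM
  rw [e.annihilator_eq, Module.mem_annihilator]
  constructor
  · intro H p hp m
    have h1 := H (DirectSum.lof (SymAlg R n) n.Partition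
      (fun p => Fin (u p) → PermModule R p) p fun _ => m)
    rw [← map_smul] at h1
    have h2 := DirectSum.of_injective (β := fun p => Fin (u p) → PermModule R p) p
      (h1.trans (map_zero _).symm)
    exact congrFun h2 ⟨0, Nat.pos_of_ne_zero ((hu p).2 hp)⟩
  · intro H y
    refine DFinsupp.ext fun p => funext fun j => ?_
    exact H p ((hu p).1 (by have := j.2; omega)) (y p j)

theorem hasShape_insertionFilling (σ : Equiv.Perm (Fin n)) :
    HasShape (rsShape σ) fun a => (insertionFilling σ a).1 :=
  card_row_eq (isStandardFilling_insertionFilling σ).1 (lt_part_iff_insertionFilling σ)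

theorem hasShape_recordingFilling (σ : Equiv.Perm (Fin n)) :
    HasShape (rsShape σ) fun i => (recordingFilling σ i).1 :=
  card_row_eq (isStandardFilling_recordingFilling σ).1 (lt_part_iff_recordingFilling σ)

theorem rsCoeff_eq_zero {Γ : Set n.Partition} {x : SymAlg R n}
    (hx : ∀ p ∈ Γ, ∀ m : PermModule R p, x • m = 0) {σ : Equiv.Perm (Fin n)}
    (hσ : σ ∈ permsOfShape Γ) : rsCoeff R σ x = 0 :=
  (smul_permModule_eq_zero_iff _ x).1 (hx _ hσ) _ _ (hasShape_recordingFilling σ)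
    (hasShape_insertionFilling σ)

/-- A combination of permutations with shape in `Γ` that annihilates all `M(p)`, `p ∈ Γ`, is
trivial. -/
theorem eq_zero_of_smul_permModule_eq_zero {Γ : Set n.Partition} {μ : n.Partition}
    (hμ : ∀ q, q ∈ Γ ↔ μ ≤ q) [Fintype (permsOfShape Γ)] {a : permsOfShape Γ → R}
    (ha : ∀ p ∈ Γ, ∀ m : PermModule R p,
      (∑ σ, a σ • MonoidAlgebra.of R _ (σ : Equiv.Perm (Fin n))) • m = 0) : a = 0 := by
  have hup : IsUpperSet Γ := fun p q hpq hp => (hμ q).2 (((hμ p).1 hp).trans hpq)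
  let L : (permsOfShape Γ → R) →ₗ[R] SymAlg R n := Fintype.linearCombination R
    fun σ : permsOfShape Γ => MonoidAlgebra.of R _ (σ : Equiv.Perm (Fin n))
  let Φ := LinearMap.pi fun σ : permsOfShape Γ => rsCoeff R (σ : Equiv.Perm (Fin n))
  have hL : LinearMap.range L = shapeSpan R Γ := by
    rw [Fintype.range_linearCombination, shapeSpan, Set.image_eq_range]
  -- `Φ` is onto and kills `I_R(Δ)^†`, a complement up to overlap of the range of `L`; so nothing is
  -- lost by restricting to that range.
  have hsurj : Function.Surjective (Φ ∘ₗ L) := by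
    intro y
    obtain ⟨x, rfl⟩ := surjective_rsCoeff (R := R) (permsOfShape Γ) y
    have hx : x ∈ shapeSpan R Γ ⊔ daggerIdeal R (transpose '' Γ)ᶜ := by
      rw [shapeSpan_sup_daggerIdeal hμ]; trivial
    obtain ⟨s, hs, d, ⟨d, hd, rfl⟩, rfl⟩ := Submodule.mem_sup.1 hx
    rw [← hL] at hs
    obtain ⟨b, rfl⟩ := hs
    refine ⟨b, ?_⟩
    have h0 : Φ (dagger R n d) = 0 := funext fun σ =>
      rsCoeff_eq_zero (fun p hp m => dagger_mem_annihilator hup hp hd m) σ.2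
    change Φ (L b) = Φ (L b + dagger R n d)
    rw [map_add, h0, add_zero]
  refine OrzechProperty.injective_of_surjective_endomorphism _ hsurj ?_
  rw [map_zero]
  exact funext fun σ => rsCoeff_eq_zero ha σ.2

/-- In a finite poset every element of `Γ` lies above a minimal one, and there is only one. -/
theorem exists_forall_mem_iff_le {Γ : Set n.Partition} (hΓ : IsUpperSet Γ)
    (hmin : ∃! μ, Minimal (· ∈ Γ) μ) : ∃ μ, ∀ q, q ∈ Γ ↔ μ ≤ q := by
  obtain ⟨μ, hμ, huniq⟩ := hmin
  refine ⟨μ, fun q => ⟨fun hq => ?_, fun h => hΓ h hμ.1⟩⟩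
  obtain ⟨ν, hle, hν⟩ := (Set.toFinite Γ).exists_le_minimal hq
  exact huniq ν hν ▸ hle

end Conclusion

end YoungPerm

open YoungPerm in
/-- `Γ ⊆ Par(n)` is co-saturated with a unique minimal element, `M` is a Young permutation module
of type `Γ` over `R Sym(n)`, and `Δ = Par(n) \ Γ*`. -/
theorem corollary2p10 {R : Type*} [CommRing R] {n : ℕ} (hn : 0 < n)
    (Γ : Set n.Partition) (hΓ : IsUpperSet Γ) (hmin : ∃! μ, Minimal (· ∈ Γ) μ)
    {M : Type*} [AddCommGroup M] [Module R M] [Module (SymAlg R n) M]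
    [IsScalarTower R (SymAlg R n) M] (hM : IsYoungPermModuleOfType R Γ M) :
    Function.Injective
        ((Algebra.lsmul R R M : SymAlg R n →ₐ[R] Module.End R M).toLinearMap.domRestrict
          (shapeSpan R Γ)) ∧
      (Module.annihilator (SymAlg R n) M : Set (SymAlg R n)) =
        dagger R n '' (youngIdeal R (transpose '' Γ)ᶜ : Set (SymAlg R n)) ∧
      ∃ b : Module.Basis (permsOfShape Γ) R (SymAlg R n ⧸ Module.annihilator (SymAlg R n) M),
        ∀ σ : permsOfShape Γ,
          b σ = Submodule.Quotient.mk (MonoidAlgebra.of R (Equiv.Perm (Fin n)) σ) := by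
  classical
  obtain ⟨μ, hμ⟩ := exists_forall_mem_iff_le hΓ hmin
  have hann := mem_annihilator_iff hM
  have hindep : ∀ a : permsOfShape Γ → R,
      ∑ σ, a σ • MonoidAlgebra.of R _ (σ : Equiv.Perm (Fin n)) ∈
        Module.annihilator (SymAlg R n) M → a = 0 := fun a ha =>
    eq_zero_of_smul_permModule_eq_zero hμ ((hann _).1 ha)
  have hdisj : ∀ x ∈ shapeSpan R Γ, x ∈ Module.annihilator (SymAlg R n) M → x = 0 := by
    intro x hx hxa
    rw [shapeSpan, Set.image_eq_range, ← Fintype.range_linearCombination] at hx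
    obtain ⟨a, rfl⟩ := hx
    rw [hindep a hxa, map_zero]
  have hdag : ∀ d ∈ daggerIdeal R (transpose '' Γ)ᶜ, d ∈ Module.annihilator (SymAlg R n) M := by
    rintro _ ⟨d, hd, rfl⟩
    exact (hann _).2 fun p hp m => dagger_mem_annihilator hΓ hp hd m
  have hsum : ∀ x : SymAlg R n,
      ∃ s ∈ shapeSpan R Γ, ∃ d ∈ daggerIdeal R (transpose '' Γ)ᶜ, s + d = x := fun x =>
    Submodule.mem_sup.1 (by rw [shapeSpan_sup_daggerIdeal hμ]; trivial)
  refine ⟨?_, ?_, ?_⟩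
  · rw [injective_iff_map_eq_zero]
    rintro ⟨x, hx⟩ h
    refine Subtype.ext (hdisj x hx (Module.mem_annihilator.2 fun m => ?_))
    exact LinearMap.congr_fun h m
  · refine Set.Subset.antisymm (fun x hx => ?_) (fun x hx => hdag x hx)
    obtain ⟨s, hs, d, hd, rfl⟩ := hsum x
    -- `s = (s + d) - d` lies in the annihilator as well as in `RG(Γ)`.
    have h0 : s = 0 := hdisj s hs (by simpa using Submodule.sub_mem _ hx (hdag d hd))
    rw [h0, zero_add]
    exact hd
  · let q : SymAlg R n →ₗ[R] SymAlg R n ⧸ Module.annihilator (SymAlg R n) M :=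
      (Module.annihilator (SymAlg R n) M).mkQ.restrictScalars R
    have hli : LinearIndependent R fun σ : permsOfShape Γ =>
        q (MonoidAlgebra.of R (Equiv.Perm (Fin n)) σ) := by
      rw [Fintype.linearIndependent_iff]
      intro a ha
      refine congrFun (hindep a ?_)
      simp only [← map_smul, ← map_sum] at ha
      exact (Submodule.Quotient.mk_eq_zero _).1 ha
    have hspan : ⊤ ≤ Submodule.span R (Set.range fun σ : permsOfShape Γ =>
        q (MonoidAlgebra.of R (Equiv.Perm (Fin n)) σ)) := by
      rintro y -
      obtain ⟨x, rfl⟩ := Submodule.Quotient.mk_surjective _ y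
      obtain ⟨s, hs, d, hd, rfl⟩ := hsum x
      have h1 : q (s + d) = q s := by
        rw [map_add, show q d = 0 from (Submodule.Quotient.mk_eq_zero _).2 (hdag d hd), add_zero]
      change q (s + d) ∈ _
      rw [h1]
      have h2 := Submodule.mem_map_of_mem (f := q) hs
      rw [shapeSpan, Submodule.map_span, ← Set.image_comp, Set.image_eq_range] at h2
      exact h2
    exact ⟨Module.Basis.mk hli hspan, fun σ => Module.Basis.mk_apply hli hspan σ⟩
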